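/- **Conventions.** $M$ is a smooth (Hausdorff, finite-dimensional) manifold and all bundles are real smooth vector bundles of finite rank over $M$. A *Lie algebroid* $(A,[\cdot,\cdot],\rho)$ over $M$ is a vector bundle $A$ with a bundle map $\rho:A\to TM$ and a Lie bracket on $\Gamma(A)$ such that $\rho[X,Y]=[\rho X,\rho Y]$ and $[X,fY]=f[X,Y]+(\rho(X)f)Y$. Let $d$ be its differential on $\Gamma(\wedge^\bullet A^*)$ (Cartan formula). A section $\phi\in\Gamma(A^*)$ is a *1-cocycle* if $\phi[X,Y]=\rho(X)(\phi(Y))-\rho(Y)(\phi(X))$; then put $d^{\phi}\omega=d\omega+\phi\wedge\omega$ and $\mathcal L^{\phi}_X=d^\phi\iota_X+\iota_Xd^\phi$ on $\Gamma(\wedge^\bullet A^*)$. With the Schouten bracket on $\Gamma(\wedge^\bullet A)$ put, for $P\in\Gamma(\wedge^pA)$ and $X\in\Gamma(A)$, $[X,P]^{\phi}=[X,P]-(p-1)\phi(X)P$, $\mathcal L^{\phi}_XP=[X,P]^{\phi}$ and $[P,X]^\phi=-[X,P]^\phi$. Suppose that $A$ and the dual bundle $A^*$ both carry Lie algebroid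 structures, with 1-cocycles $\phi_0\in\Gamma(A^*)$ of $A$ and $X_0\in\Gamma(A)$ of $A^*$; the objects belonging to $A^*$ carry a star. The pair $((A,\phi_0),(A^*,X_0))$ is a *generalized Lie bialgebroid* over $M$ if for all $X,Y\in\Gamma(A)$, all $p\ge 0$ and all $P\in\Gamma(\wedge^pA)$ $$d_*^{X_0}[X,Y]=[d_*^{X_0}X,Y]^{\phi_0}+[X,d_*^{X_0}Y]^{\phi_0},\qquad \mathcal L^{X_0}_{*\phi_0}P+\mathcal L^{\phi_0}_{X_0}P=0 .$$ Its *induced bracket* on $C^\infty(M)$ is $\{f,g\}=\langle d^{\phi_0}f,d_*^{X_0}g\rangle$. A *morphism* $((A,\phi_0),(A^*,X_0))\to((B,\psi_0),(B^*,Y_0))$ of generalized Lie bialgebroids over $M$ is a morphism of Lie algebroids $\Phi:A\to B$ over $\mathrm{id}_M$ whose dual $\Phi^*:B^*\to A^*$ is also a morphism of Lie algebroids, with $\Phi(X_0)=Y_0$ and $\Phi^*(\psi_0)=\phi_0$. A *Jacobi structure* on $M$ is a bilinear skew-symmetric bracket on $C^\infty(M)$ satisfying the Jacobi identity and $\{fg,h\}=f\{g,h\}+g\{f,h\}-fg\{1,h\}$.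 Its bivector field $\Lambda$ and vector field $E$ are given by $E(f)=\{1,f\}$ and $\Lambda(\delta f,\delta g)=\{f,g\}-fE(g)+gE(f)$, where $\delta$ is the de Rham differential. Let $TM\times\mathbb R$ be the Lie algebroid with bracket $[(X,f),(Y,g)]=([X,Y],X(g)-Y(f))$ and anchor $(X,f)\mapsto X$. With $\langle\beta,\Lambda^\sharp\alpha\rangle=\Lambda(\alpha,\beta)$, give its dual $T^*M\times\mathbb R$ the anchor $(\alpha,f)\mapsto\Lambda^\sharp\alpha+fE$ and the bracket $$\begin{aligned}{}[(\alpha,f),(\beta,g)]=\big(&\mathcal L_{\Lambda^\sharp\alpha}\beta-\mathcal L_{\Lambda^\sharp\beta}\alpha-\delta(\Lambda(\alpha,\beta))+f\mathcal L_E\beta-g\mathcal L_E\alpha-\iota_E(\alpha\wedge\beta),\\&\Lambda(\beta,\alpha)+\Lambda^\sharp(\alpha)(g)-\Lambda^\sharp(\beta)(f)+fE(g)-gE(f)\big).\end{aligned}$$ **Theorem.** Let $((A,\phi_0),(A^*,X_0))$ be a generalized Lie bialgebroid over $M$. 1. Suppose that $\operatorname{rank}A\ne1$. Then the induced bracket is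 a Jacobi structure, and it has a bivector field $\Lambda$ and a vector field $E$ as above. For these, $T^*M\times\mathbb R$ with the anchor and bracket above is a Lie algebroid, $((TM\times\mathbb R,(0,1)),(T^*M\times\mathbb R,(-E,0)))$ is a generalized Lie bialgebroid, and $$\Phi_A:A\to TM\times\mathbb R,\qquad \Phi_A(X)=(\rho(X),\phi_0(X)),$$ is a morphism of generalized Lie bialgebroids from $((A,\phi_0),(A^*,X_0))$ to it. 2. If $\Psi:((A,\phi_0),(A^*,X_0))\to((B,\psi_0),(B^*,Y_0))$ is a morphism of generalized Lie bialgebroids over $M$ (of any ranks), then the two induced brackets on $C^\infty(M)$ are equal. -/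

import Mathlib

open Bundle Manifold ContDiff Topology
set_option linter.unusedSectionVars false
noncomputable section
namespace GLB

variable {E : Type*} [NormedAddCommGroup E] [NormedSpace ℝ E] [FiniteDimensional ℝ E]
  {M : Type*} [TopologicalSpace M] [ChartedSpace E M] [IsManifold 𝓘(ℝ, E) ∞ M] [T2Space M]
  {F : Type*} [NormedAddCommGroup F] [NormedSpace ℝ F] [FiniteDimensional ℝ F]
  {V : M → Type*} [∀ x, AddCommGroup (V x)] [∀ x, Module ℝ (V x)] [∀ x, TopologicalSpace (V x)]
  [∀ x, IsTopologicalAddGroup (V x)] [∀ x, ContinuousSMul ℝ (V x)]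
  [TopologicalSpace (TotalSpace F V)] [FiberBundle F V] [VectorBundle ℝ F V]
  [ContMDiffVectorBundle ∞ F V 𝓘(ℝ, E)]
  {F' : Type*} [NormedAddCommGroup F'] [NormedSpace ℝ F'] [FiniteDimensional ℝ F']
  {W : M → Type*} [∀ x, AddCommGroup (W x)] [∀ x, Module ℝ (W x)] [∀ x, TopologicalSpace (W x)]
  [∀ x, IsTopologicalAddGroup (W x)] [∀ x, ContinuousSMul ℝ (W x)]
  [TopologicalSpace (TotalSpace F' W)] [FiberBundle F' W] [VectorBundle ℝ F' W]
  [ContMDiffVectorBundle ∞ F' W 𝓘(ℝ, E)]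

variable (E M) in
/-- The ring `C^∞(M)`. -/
abbrev Func := C^∞⟮𝓘(ℝ, E), M; ℝ⟯

variable (E F V) in
/-- The smooth sections `Γ(V)` of a bundle `V` with typical fibre `F`. -/
abbrev Sec := Cₛ^∞⟮𝓘(ℝ, E); F, V⟯

/-- Fibres of the dual bundle. -/
abbrev DualBundle (V : M → Type*) [∀ x, AddCommGroup (V x)] [∀ x, Module ℝ (V x)]
    [∀ x, TopologicalSpace (V x)] : M → Type _ :=
  fun x => V x →L[ℝ] Trivial M ℝ x

variable (E F V) in
/-- The smooth sections of the dual bundle. -/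
abbrev DualSec := Cₛ^∞⟮𝓘(ℝ, E); F →L[ℝ] ℝ, DualBundle V⟯

variable (E F V F' W) in
/-- Smooth bundle maps `V → W` over the identity of `M`: smooth sections of the bundle of
fibrewise linear maps. -/
abbrev BundleMap := Cₛ^∞⟮𝓘(ℝ, E); F →L[ℝ] F', fun x => V x →L[ℝ] W x⟯

instance : SMul (Func E M) (Sec E F V) :=
  ⟨fun f s => ⟨fun x => f x • s x, f.contMDiff.smul_section s.contMDiff⟩⟩

theorem smul_apply (f : Func E M) (s : Sec E F V) (x : M) :
    (f • s) x = f x • s x := rfl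

instance : Module (Func E M) (Sec E F V) where
  one_smul s := by ext x; exact one_smul ℝ (s x)
  mul_smul f g s := by ext x; exact mul_smul (f x) (g x) (s x)
  smul_zero f := by ext x; exact smul_zero (f x)
  smul_add f s t := by ext x; exact smul_add (f x) (s x) (t x)
  add_smul f g s := by ext x; exact add_smul (f x) (g x) (s x)
  zero_smul s := by ext x; exact zero_smul ℝ (s x)

theorem exists_bump {u : Set M} (hu : IsOpen u) {x : M} (hx : x ∈ u) :
    ∃ ψ : Func E M, tsupport ψ ⊆ u ∧ ∀ᶠ y in 𝓝 x, ψ y = 1 := by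
  obtain ⟨f, -, hf⟩ := (SmoothBumpFunction.nhds_basis_tsupport (I := 𝓘(ℝ, E)) x).mem_iff.1
    (hu.mem_nhds hx)
  exact ⟨⟨f, f.contMDiff⟩, hf, f.eventuallyEq_one⟩

/-- A smooth local section agrees near a point with a smooth global section. -/
theorem exists_section {u : Set M} (hu : IsOpen u) {x : M} (hx : x ∈ u) (σ : ∀ y, V y)
    (hσ : ContMDiffOn 𝓘(ℝ, E) (𝓘(ℝ, E).prod 𝓘(ℝ, F)) ∞ (fun y => TotalSpace.mk' F y (σ y)) u) :
    ∃ s : Sec E F V, ∀ᶠ y in 𝓝 x, s y = σ y := by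
  obtain ⟨ψ, h1, h2⟩ := exists_bump (E := E) hu hx
  refine ⟨⟨_, ContMDiffOn.smul_section_of_tsupport ψ.contMDiff.contMDiffOn hu h1 hσ⟩, ?_⟩
  filter_upwards [h2] with y hy
  show ψ y • σ y = σ y
  rw [hy, one_smul]

theorem exists_section_eq (x : M) (v : V x) : ∃ s : Sec E F V, s x = v := by
  set e := trivializationAt F V x
  have hx : x ∈ e.baseSet := FiberBundle.mem_baseSet_trivializationAt' x
  let b := Module.finBasis ℝ F
  have : ∀ i, ∃ s : Sec E F V, s x = e.localFrame b i x := fun i => by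
    obtain ⟨s, hs⟩ := exists_section e.open_baseSet hx _
      (e.contMDiffOn_localFrame_baseSet (I := 𝓘(ℝ, E)) ∞ b i)
    exact ⟨s, hs.self_of_nhds⟩
  choose s hs using this
  refine ⟨∑ i, (e.basisAt b hx).repr v i • s i, ?_⟩
  have h := map_sum (ContMDiffSection.coeAddHom 𝓘(ℝ, E) F ∞ V)
    (fun i => (e.basisAt b hx).repr v i • s i) Finset.univ
  have h' := congrFun h x
  simp only [ContMDiffSection.coeAddHom_apply, Finset.sum_apply] at h'
  rw [h']
  conv_rhs => rw [← (e.basisAt b hx).sum_repr v]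
  refine Finset.sum_congr rfl fun i _ => ?_
  rw [ContMDiffSection.coe_smul, Pi.smul_apply, hs, e.localFrame_apply_of_mem_baseSet b hx]

/-- A `C^∞(M)`-linear map between sections is tensorial. -/
theorem tensorial (T : Sec E F V →ₗ[Func E M] Sec E F' W)
    {s : Sec E F V} {x : M} (hs : s x = 0) : T s x = 0 := by
  set e := trivializationAt F V x
  have hx : x ∈ e.baseSet := FiberBundle.mem_baseSet_trivializationAt' x
  let b := Module.finBasis ℝ F
  obtain ⟨ψ, h1, h2⟩ := exists_bump (E := E) e.open_baseSet hx
  let c (i) : Func E M := ⟨fun y => ψ y * e.localFrameCoeff 𝓘(ℝ, E) b i y (s y), by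
    have := contMDiffOn_localFrameCoeff (k := ∞) (I := 𝓘(ℝ, E)) (e := e) b e.open_baseSet
      subset_rfl s.contMDiff.contMDiffOn i
    refine contMDiff_of_tsupport fun y hy => ?_
    have hy' : y ∈ e.baseSet := h1 (tsupport_mul_subset_left hy)
    exact (ψ.contMDiff y).mul (this.contMDiffAt (e.open_baseSet.mem_nhds hy'))⟩
  let t (i) : Sec E F V :=
    ⟨_, ContMDiffOn.smul_section_of_tsupport ψ.contMDiff.contMDiffOn e.open_baseSet h1
      (e.contMDiffOn_localFrame_baseSet (I := 𝓘(ℝ, E)) ∞ b i)⟩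
  have key : (ψ * ψ) • s = ∑ i, c i • t i := by
    ext y
    have h := congrFun (map_sum (ContMDiffSection.coeAddHom 𝓘(ℝ, E) F ∞ V)
      (fun i => c i • t i) Finset.univ) y
    simp only [ContMDiffSection.coeAddHom_apply, Finset.sum_apply] at h
    rw [h]
    show (ψ y * ψ y) • s y = ∑ i, (ψ y * e.localFrameCoeff 𝓘(ℝ, E) b i y (s y)) •
      (ψ y • e.localFrame b i y)
    by_cases hy : y ∈ e.baseSet
    · conv_lhs => rw [e.eq_sum_localFrameCoeff_smul (I := 𝓘(ℝ, E)) (b := b) (s := s) hy]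
      rw [Finset.smul_sum]
      refine Finset.sum_congr rfl fun i _ => ?_
      rw [smul_smul, smul_smul]; congr 1; ring
    · have : ψ y = 0 := image_eq_zero_of_notMem_tsupport fun h => hy (h1 h)
      simp [this]
  have h := congrArg (fun r => T r x) key
  simp only [map_smul, map_sum] at h
  have h' := congrFun (map_sum (ContMDiffSection.coeAddHom 𝓘(ℝ, E) F' ∞ W)
      (fun i => c i • T (t i)) Finset.univ) x
  simp only [ContMDiffSection.coeAddHom_apply, Finset.sum_apply] at h'
  rw [h', smul_apply] at h
  have hψ : (ψ * ψ) x = 1 := by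
    show ψ x * ψ x = 1
    rw [h2.self_of_nhds, one_mul]
  rw [hψ, one_smul] at h
  rw [h]
  refine Finset.sum_eq_zero fun i _ => ?_
  rw [smul_apply]
  have : c i x = 0 := by
    show ψ x * e.localFrameCoeff 𝓘(ℝ, E) b i x (s x) = 0
    rw [hs]; simp
  rw [this, zero_smul]

theorem tensorial_eq (T : Sec E F V →ₗ[Func E M] Sec E F' W)
    {s t : Sec E F V} {x : M} (hs : s x = t x) : T s x = T t x := by
  have : T (s - t) x = 0 := tensorial T (by
    rw [ContMDiffSection.coe_sub, Pi.sub_apply, hs, sub_self])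
  rw [map_sub, ContMDiffSection.coe_sub, Pi.sub_apply, sub_eq_zero] at this
  exact this

/-- A fibrewise linear map which takes smooth sections to smooth sections is smooth. -/
theorem contMDiff_hom (φ : ∀ x, V x →L[ℝ] W x)
    (h : ∀ s : Sec E F V, ContMDiff 𝓘(ℝ, E) (𝓘(ℝ, E).prod 𝓘(ℝ, F')) ∞
      (fun x => TotalSpace.mk' F' x (φ x (s x)))) :
    ContMDiff 𝓘(ℝ, E) (𝓘(ℝ, E).prod 𝓘(ℝ, F →L[ℝ] F')) ∞
      (fun x => TotalSpace.mk' (F →L[ℝ] F') (E := fun x => V x →L[ℝ] W x) x (φ x)) := by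
  intro x
  rw [contMDiffAt_hom_bundle]
  refine ⟨contMDiffAt_id, ?_⟩
  set e := trivializationAt F V x
  have hx : x ∈ e.baseSet := FiberBundle.mem_baseSet_trivializationAt' x
  have hx' : x ∈ (trivializationAt F' W x).baseSet := FiberBundle.mem_baseSet_trivializationAt' x
  let b := Module.finBasis ℝ F
  let L (y : M) : F →L[ℝ] F' := ContinuousLinearMap.inCoordinates F V F' W x y x y (φ y)
  have hL (i) : ContMDiffAt 𝓘(ℝ, E) 𝓘(ℝ, F') ∞ (fun y => L y (b i)) x := by
    obtain ⟨s, hs⟩ := exists_section e.open_baseSet hx _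
      (e.contMDiffOn_localFrame_baseSet (I := 𝓘(ℝ, E)) ∞ b i)
    have h' := h s x
    rw [contMDiffAt_section] at h'
    refine h'.congr_of_eventuallyEq ?_
    filter_upwards [hs, e.open_baseSet.mem_nhds hx,
      (trivializationAt F' W x).open_baseSet.mem_nhds hx'] with y h1 h2 h3
    show ContinuousLinearMap.inCoordinates F V F' W x y x y (φ y) (b i) = _
    rw [ContinuousLinearMap.inCoordinates_eq h2 h3, h1, e.localFrame_apply_of_mem_baseSet b h2]
    simp [Trivialization.basisAt, e]
  have hsum : L = fun y => ∑ i, ContinuousLinearMap.smulRightL ℝ F F'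
      (LinearMap.toContinuousLinearMap (b.coord i)) (L y (b i)) := by
    funext y
    refine ContinuousLinearMap.coe_injective (b.ext fun j => ?_)
    simp [Finsupp.single_apply]
  show ContMDiffAt _ _ _ L x
  rw [hsum]
  refine ContMDiffAt.sum fun i _ => ?_
  exact (ContinuousLinearMap.contMDiff _).contMDiffAt.comp x (hL i)


/-- The map induced on sections by a smooth bundle map. -/
def homMap (Φ : BundleMap E F V F' W) :
    Sec E F V →ₗ[Func E M] Sec E F' W where
  toFun s := ⟨fun x => Φ x (s x), ContMDiff.clm_bundle_apply Φ.contMDiff s.contMDiff⟩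
  map_add' s t := by ext x; exact map_add (Φ x) (s x) (t x)
  map_smul' f s := by ext x; exact map_smul (Φ x) (f x) (s x)

theorem homMap_apply (Φ : BundleMap E F V F' W)
    (s : Sec E F V) (x : M) : homMap Φ s x = Φ x (s x) := rfl

def fibreMap (T : Sec E F V →ₗ[Func E M] Sec E F' W) (x : M) :
    V x →L[ℝ] W x :=
  have : T2Space (V x) := FiberBundle.t2Space F V x
  have : FiniteDimensional ℝ (V x) := VectorBundle.finiteDimensional ℝ F V x
  LinearMap.toContinuousLinearMap
    { toFun := fun v => T (exists_section_eq (E := E) (F := F) x v).choose x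
      map_add' := fun v w => by
        have hv := (exists_section_eq (E := E) (F := F) x v).choose_spec
        have hw := (exists_section_eq (E := E) (F := F) x w).choose_spec
        have hvw := (exists_section_eq (E := E) (F := F) x (v + w)).choose_spec
        rw [← Pi.add_apply, ← ContMDiffSection.coe_add, ← map_add]
        refine tensorial_eq T ?_
        rw [hvw, ContMDiffSection.coe_add, Pi.add_apply, hv, hw]
      map_smul' := fun c v => by
        have hv := (exists_section_eq (E := E) (F := F) x v).choose_spec
        have hcv := (exists_section_eq (E := E) (F := F) x (c • v)).choose_spec
        let C : Func E M := ⟨fun _ => c, contMDiff_const⟩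
        have h := tensorial_eq T (x := x) (hcv.trans (by
          rw [smul_apply, hv]; rfl : c • v = (C • (exists_section_eq (E := E) (F := F) x v).choose) x))
        rw [h, map_smul]
        rfl }

theorem fibreMap_apply
    (T : Sec E F V →ₗ[Func E M] Sec E F' W)
    (s : Sec E F V) (x : M) : fibreMap T x (s x) = T s x :=
  tensorial_eq T (exists_section_eq (E := E) (F := F) x (s x)).choose_spec

/-- The smooth bundle map determined by a `C^∞(M)`-linear map between sections. -/
def homOfLinear
    (T : Sec E F V →ₗ[Func E M] Sec E F' W) :
    BundleMap E F V F' W :=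
  ⟨fibreMap T, contMDiff_hom (fibreMap T) fun s => by
    simpa only [fibreMap_apply] using (T s).contMDiff⟩

theorem homMap_homOfLinear
    (T : Sec E F V →ₗ[Func E M] Sec E F' W) :
    homMap (homOfLinear T) = T := by
  ext s x
  exact fibreMap_apply T s x

def ofTrivial :
    Cₛ^∞⟮𝓘(ℝ, E); ℝ, Trivial M ℝ⟯ ≃ₗ[Func E M] Func E M where
  toFun s := ⟨fun x => s x, fun x => by
    have := s.contMDiff x
    rw [contMDiffAt_section] at this
    simpa using this⟩
  invFun f := ⟨fun x => f x, fun x => by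
    rw [contMDiffAt_section]
    simpa using f.contMDiff x⟩
  map_add' _ _ := rfl
  map_smul' _ _ := rfl
  left_inv _ := rfl
  right_inv _ := rfl

/-- The pairing `⟨ξ, X⟩` of a section of the dual bundle with a section, as a linear form. -/
def pair (ξ : DualSec E F V) :
    Sec E F V →ₗ[Func E M] Func E M :=
  ofTrivial.toLinearMap ∘ₗ homMap ξ

theorem pair_apply (ξ : DualSec E F V) (s : Sec E F V) (x : M) :
    pair ξ s x = ξ x (s x) := rfl

def dualOfLinear (θ : Sec E F V →ₗ[Func E M] Func E M) :
    DualSec E F V :=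
  homOfLinear (ofTrivial.symm.toLinearMap ∘ₗ θ)

theorem pair_dualOfLinear
    (θ : Sec E F V →ₗ[Func E M] Func E M) :
    pair (dualOfLinear θ) = θ := by
  unfold pair dualOfLinear
  rw [homMap_homOfLinear]
  rfl

/-- Evaluation at a section `X`, a linear form on the sections of the dual bundle. -/
def evalAt (X : Sec E F V) : DualSec E F V →ₗ[Func E M] Func E M where
  toFun ξ := pair ξ X
  map_add' _ _ := rfl
  map_smul' _ _ := rfl

/-- A section `X` as a 1-form on the dual bundle, regarded as a function of one section. -/
def oneVec (X : Sec E F V) (ξ : Fin 1 → DualSec E F V) : Func E M := evalAt X (ξ 0)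

theorem exists_bidual
    (θ : DualSec E F V →ₗ[Func E M] Func E M) :
    ∃ s : Sec E F V, ∀ ξ, pair ξ s = θ ξ := by
  have h1 (x : M) : ∃ v : V x, ∀ ξ : DualSec E F V, ξ x v = θ ξ x := by
    have : T2Space (V x) := FiberBundle.t2Space F V x
    have : FiniteDimensional ℝ (V x) := VectorBundle.finiteDimensional ℝ F V x
    let ev : Module.Dual ℝ (Module.Dual ℝ (V x)) :=
      { toFun := fun α => dualOfLinear θ x (LinearMap.toContinuousLinearMap α : V x →L[ℝ] ℝ)
        map_add' := fun α β => by
          rw [map_add]; exact map_add _ _ _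
        map_smul' := fun c α => by
          rw [map_smul]; exact map_smul _ _ _ }
    refine ⟨(Module.evalEquiv ℝ (V x)).symm ev, fun ξ => ?_⟩
    have h := Module.apply_evalEquiv_symm_apply ℝ (V x) ((ξ x : V x →L[ℝ] ℝ) : V x →ₗ[ℝ] ℝ) ev
    have h2 := congrArg (fun T => T ξ x) (pair_dualOfLinear θ)
    refine Eq.trans h (Eq.trans ?_ h2)
    rfl
  choose v hv using h1
  refine ⟨⟨v, fun x => ?_⟩, fun ξ => ?_⟩
  · set e := trivializationAt F V x
    have hx : x ∈ e.baseSet := FiberBundle.mem_baseSet_trivializationAt' x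
    let b := Module.finBasis ℝ F
    obtain ⟨ψ, h1, h2⟩ := exists_bump (E := E) e.open_baseSet hx
    rw [contMDiffAt_iff_localFrameCoeff (e := e) b hx]
    intro i
    let ζ : Sec E F V →ₗ[Func E M] Func E M :=
      { toFun := fun s => ⟨fun y => ψ y * e.localFrameCoeff 𝓘(ℝ, E) b i y (s y), by
          have := contMDiffOn_localFrameCoeff (k := ∞) (I := 𝓘(ℝ, E)) (e := e) b e.open_baseSet
            subset_rfl s.contMDiff.contMDiffOn i
          refine contMDiff_of_tsupport fun y hy => ?_
          have hy' : y ∈ e.baseSet := h1 (tsupport_mul_subset_left hy)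
          exact (ψ.contMDiff y).mul (this.contMDiffAt (e.open_baseSet.mem_nhds hy'))⟩
        map_add' := fun s t => by
          ext y
          show ψ y * _ = ψ y * _ + ψ y * _
          rw [← mul_add, ← map_add]; rfl
        map_smul' := fun f s => by
          ext y
          show ψ y * e.localFrameCoeff 𝓘(ℝ, E) b i y (f y • s y) = f y * (ψ y * _)
          rw [map_smul, smul_eq_mul]; ring }
    have hζ := (θ (dualOfLinear ζ)).contMDiff x
    refine hζ.congr_of_eventuallyEq ?_
    filter_upwards [h2] with y hy
    rw [← hv]
    obtain ⟨s, hs⟩ := exists_section_eq (E := E) (F := F) y (v y)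
    have h3 := congrArg (fun T => T s y) (pair_dualOfLinear ζ)
    have h4 : dualOfLinear ζ y (s y) = ψ y * e.localFrameCoeff 𝓘(ℝ, E) b i y (s y) := h3
    rw [hs, hy, one_mul] at h4
    exact h4.symm
  · ext x
    exact hv x ξ

/-- The section of `V` determined by a `C^∞(M)`-linear form on the sections of the dual bundle. -/
def ofBidual (θ : DualSec E F V →ₗ[Func E M] Func E M) : Sec E F V := (exists_bidual θ).choose

theorem pair_ofBidual (θ : DualSec E F V →ₗ[Func E M] Func E M) (ξ : DualSec E F V) :
    pair ξ (ofBidual θ) = θ ξ :=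
  (exists_bidual θ).choose_spec ξ

variable (E M) in
/-- Smooth vector fields. -/
abbrev VField := Cₛ^∞⟮𝓘(ℝ, E); E, (TangentSpace 𝓘(ℝ, E) : M → Type _)⟯

/-- Section pairings separate the sections of the dual bundle. -/
theorem dual_ext {ξ η : DualSec E F V}
    (h : ∀ s : Sec E F V, pair ξ s = pair η s) : ξ = η := by
  refine ContMDiffSection.ext fun x => ContinuousLinearMap.ext fun (v : V x) => ?_
  obtain ⟨s, rfl⟩ := exists_section_eq (E := E) (F := F) x v
  have h1 : pair ξ s x = pair η s x := congrArg (fun f => f x) (h s)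
  exact h1

/-- Sections of the dual bundle separate sections. -/
theorem sec_ext {s t : Sec E F V}
    (h : ∀ ξ : DualSec E F V, pair ξ s = pair ξ t) : s = t := by
  ext x
  have : T2Space (V x) := FiberBundle.t2Space F V x
  have : FiniteDimensional ℝ (V x) := VectorBundle.finiteDimensional ℝ F V x
  rw [← sub_eq_zero]
  refine (Module.forall_dual_apply_eq_zero_iff ℝ (s x - t x)).1 fun α => ?_
  obtain ⟨ξ, hξ⟩ := exists_section_eq (E := E) (F := F →L[ℝ] ℝ) (V := DualBundle V) x
    (LinearMap.toContinuousLinearMap α : V x →L[ℝ] ℝ)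
  have h1 := congrArg (fun f => f x) (h ξ)
  have h2 : ξ x (s x) = ξ x (t x) := h1
  rw [hξ] at h2
  have h3 : α (s x) = α (t x) := h2
  rw [map_sub, h3, sub_self]

/-- The derivative `X f` of a function along a vector field. -/
def der (X : VField E M) (f : Func E M) : Func E M :=
  ⟨fun x => mvfderiv 𝓘(ℝ, E) f x (X x), by
    have : IsManifold 𝓘(ℝ, E) (∞ + 1) M := ‹IsManifold 𝓘(ℝ, E) ∞ M›
    have h1 := f.contMDiff.contMDiff_tangentMap (m := ∞) le_rfl
    exact (contMDiff_snd_tangentBundle_modelSpace ℝ 𝓘(ℝ, ℝ)).comp (h1.comp X.contMDiff)⟩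

theorem smooth_mdiff (f : Func E M) (x : M) : MDifferentiableAt 𝓘(ℝ, E) 𝓘(ℝ, ℝ) f x :=
  (f.contMDiff x).mdifferentiableAt (by simp)

theorem der_add_fun (X : VField E M) (f g : Func E M) :
    der X (f + g) = der X f + der X g := by
  ext x
  exact congrArg (fun T => T (X x)) (mvfderiv_add (smooth_mdiff f x) (smooth_mdiff g x))

theorem der_mul (X : VField E M) (f g : Func E M) :
    der X (f * g) = f * der X g + der X f * g := by
  ext x
  have := congrArg (fun T => T (X x)) (mvfderiv_mul (smooth_mdiff f x) (smooth_mdiff g x))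
  refine Eq.trans this ?_
  show f x * _ + g x * _ = f x * _ + _ * g x
  rw [mul_comm (g x)]; rfl

theorem der_sub_fun (X : VField E M) (f g : Func E M) :
    der X (f - g) = der X f - der X g := by
  rw [eq_sub_iff_add_eq, ← der_add_fun, sub_add_cancel]

theorem der_add (X Y : VField E M) (f : Func E M) :
    der (X + Y) f = der X f + der Y f := by
  ext x; exact map_add (mvfderiv 𝓘(ℝ, E) f x) _ _

theorem der_smul (h : Func E M) (X : VField E M) (f : Func E M) :
    der (h • X) f = h * der X f := by
  ext x; exact map_smul (mvfderiv 𝓘(ℝ, E) f x) _ _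

/-- The Lie bracket of smooth vector fields. -/
def vbracket (X Y : VField E M) : VField E M :=
  ⟨VectorField.mlieBracket 𝓘(ℝ, E) X Y, by
    have : IsManifold 𝓘(ℝ, E) (((⊤ : ℕ∞) : ℕ∞ω) + 1) M := ‹IsManifold 𝓘(ℝ, E) ∞ M›
    have : IsManifold 𝓘(ℝ, E) (minSmoothness ℝ 2) M := by
      rw [minSmoothness_of_isRCLikeNormedField]; infer_instance
    exact ContDiff.mlieBracket_vectorField (m := ⊤) (n := ⊤) X.contMDiff Y.contMDiff
      (by rw [minSmoothness_of_isRCLikeNormedField]; rfl)⟩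

theorem vbracket_add_right (X Y Z : VField E M) :
    vbracket X (Y + Z) = vbracket X Y + vbracket X Z := by
  ext x
  have : IsManifold 𝓘(ℝ, E) (minSmoothness ℝ 2) M := by
    rw [minSmoothness_of_isRCLikeNormedField]; infer_instance
  exact VectorField.mlieBracket_add_right Y.mdifferentiableAt Z.mdifferentiableAt

theorem vbracket_skew (X Y : VField E M) : vbracket X Y = -vbracket Y X := by
  ext x
  exact VectorField.mlieBracket_swap_apply

theorem vbracket_smul_right (X : VField E M) (f : Func E M) (Y : VField E M) :
    vbracket X (f • Y) = f • vbracket X Y + der X f • Y := by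
  ext x
  have : IsManifold 𝓘(ℝ, E) (minSmoothness ℝ 2) M := by
    rw [minSmoothness_of_isRCLikeNormedField]; infer_instance
  rw [add_comm]
  exact VectorField.mlieBracket_smul_right (smooth_mdiff f x) Y.mdifferentiableAt

theorem vbracket_jacobi (X Y Z : VField E M) :
    vbracket X (vbracket Y Z) = vbracket (vbracket X Y) Z + vbracket Y (vbracket X Z) := by
  ext x
  have : IsManifold 𝓘(ℝ, E) (minSmoothness ℝ 3) M := by
    rw [minSmoothness_of_isRCLikeNormedField]; infer_instance
  have h (X : VField E M) : ContMDiffAt 𝓘(ℝ, E) (𝓘(ℝ, E).prod 𝓘(ℝ, E)) (minSmoothness ℝ 2)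
      (fun x => (X x : TangentBundle 𝓘(ℝ, E) M)) x := by
    rw [minSmoothness_of_isRCLikeNormedField]
    exact (X.contMDiff x).of_le ENat.LEInfty.out
  exact VectorField.leibniz_identity_mlieBracket_apply (h X) (h Y) (h Z)

theorem der_vbracket (X Y : VField E M) (f : Func E M) :
    der (vbracket X Y) f = der X (der Y f) - der Y (der X f) := by
  have key (Z : VField E M) :
      der (vbracket X Y) f • Z = (der X (der Y f) - der Y (der X f)) • Z := by
    have h := vbracket_jacobi X Y (f • Z)
    simp only [vbracket_smul_right, vbracket_add_right, vbracket_jacobi X Y Z, smul_add] at h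
    rw [sub_smul]
    have h' := sub_eq_zero.2 h
    rw [← sub_eq_zero, ← neg_eq_zero, ← h']
    abel
  ext x
  by_cases hE : Subsingleton E
  · show mvfderiv 𝓘(ℝ, E) f x _ = mvfderiv 𝓘(ℝ, E) (der Y f) x _ - mvfderiv 𝓘(ℝ, E) (der X f) x _
    have h0 (v : TangentSpace 𝓘(ℝ, E) x) : v = 0 := @Subsingleton.elim E hE v 0
    rw [h0 (vbracket X Y x), h0 (X x), h0 (Y x)]
    simp
  · rw [not_subsingleton_iff_nontrivial] at hE
    obtain ⟨v, hv⟩ := exists_ne (0 : E)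
    obtain ⟨Z, hZ⟩ := exists_section_eq (E := E) (F := E)
      (V := (TangentSpace 𝓘(ℝ, E) : M → Type _)) x v
    have h := congrArg (fun W => W x) (key Z)
    simp only [smul_apply] at h
    rw [hZ] at h
    exact smul_left_injective ℝ hv h


/-! ### Lie algebroids -/

variable (E F V) in
/-- A Lie algebroid structure on the smooth vector bundle `V → M`: an anchor, which is a smooth
bundle map `V → TM`, and a Lie bracket on the smooth sections satisfying the Leibniz rule. (The
`ℝ`-linearity of the bracket in the second argument is additivity together with the Leibniz rule
for constant functions; linearity in the first argument then follows by skew-symmetry.) -/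
structure LieAlgebroid where
  bracket : Sec E F V → Sec E F V → Sec E F V
  anchor : BundleMap E F V E (TangentSpace 𝓘(ℝ, E) : M → Type _)
  bracket_add : ∀ X Y Z, bracket X (Y + Z) = bracket X Y + bracket X Z
  bracket_skew : ∀ X Y, bracket X Y = -bracket Y X
  bracket_jacobi : ∀ X Y Z,
    bracket X (bracket Y Z) = bracket (bracket X Y) Z + bracket Y (bracket X Z)
  anchor_bracket : ∀ X Y,
    homMap anchor (bracket X Y) = vbracket (homMap anchor X) (homMap anchor Y)
  bracket_smul : ∀ (X : Sec E F V) (f : Func E M) (Y : Sec E F V),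
    bracket X (f • Y) = f • bracket X Y + der (homMap anchor X) f • Y

namespace LieAlgebroid

variable (L : LieAlgebroid E F V)

/-- The anchor on sections. -/
abbrev rho : Sec E F V →ₗ[Func E M] VField E M := homMap L.anchor

/-- `φ` is a 1-cocycle: `φ[X, Y] = ρ(X)(φ(Y)) - ρ(Y)(φ(X))`. -/
def IsCocycle (φ : Sec E F V →ₗ[Func E M] Func E M) : Prop :=
  ∀ X Y, φ (L.bracket X Y) = der (L.rho X) (φ Y) - der (L.rho Y) (φ X)

/-- The differential of the Lie algebroid, by the Cartan formula. A `k`-form is regarded as a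
function of `k` sections with values in `C^∞(M)`. In the double sum, the pair of indices
`i < j + 1` of the usual formula is represented by `i ≤ j`, which accounts for its sign. -/
def d : ∀ {k : ℕ}, ((Fin k → Sec E F V) → Func E M) → (Fin (k + 1) → Sec E F V) → Func E M
  | 0, θ, X => der (L.rho (X 0)) (θ ![])
  | k + 1, θ, X =>
      (∑ i : Fin (k + 2), (-1) ^ (i : ℕ) * der (L.rho (X i)) (θ (i.removeNth X)))
      - ∑ i : Fin (k + 1), ∑ j ∈ Finset.Ici i, (-1) ^ ((i : ℕ) + (j : ℕ)) *
          θ (Matrix.vecCons (L.bracket (X i.castSucc) (X j.succ))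
            (j.removeNth (i.castSucc.removeNth X)))

/-- The wedge product `φ ∧ θ` of a 1-form with a `k`-form. -/
def wedge {k : ℕ} (φ : Sec E F V →ₗ[Func E M] Func E M)
    (θ : (Fin k → Sec E F V) → Func E M) (X : Fin (k + 1) → Sec E F V) : Func E M :=
  ∑ i : Fin (k + 1), (-1) ^ (i : ℕ) * (φ (X i) * θ (i.removeNth X))

/-- The deformed differential `d^φ θ = d θ + φ ∧ θ`. -/
def dDef {k : ℕ} (φ : Sec E F V →ₗ[Func E M] Func E M)
    (θ : (Fin k → Sec E F V) → Func E M) (X : Fin (k + 1) → Sec E F V) : Func E M :=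
  L.d θ X + wedge φ θ X

/-- The contraction `ι_X θ`. -/
def contract {k : ℕ} (X : Sec E F V) (θ : (Fin (k + 1) → Sec E F V) → Func E M)
    (Y : Fin k → Sec E F V) : Func E M :=
  θ (Matrix.vecCons X Y)

/-- The deformed Lie derivative of forms, `L^φ_X θ = d^φ (ι_X θ) + ι_X (d^φ θ)`, where `ι_X` is
zero on functions. -/
def lieForm (φ : Sec E F V →ₗ[Func E M] Func E M) (X : Sec E F V) :
    ∀ {k : ℕ}, ((Fin k → Sec E F V) → Func E M) → (Fin k → Sec E F V) → Func E M
  | 0, θ, Y => contract X (L.dDef φ θ) Y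
  | _ + 1, θ, Y => L.dDef φ (contract X θ) Y + contract X (L.dDef φ θ) Y

/-- The Lie derivative of a section of the dual bundle:
`⟨L_X ξ, Z⟩ = ρ(X)⟨ξ, Z⟩ - ⟨ξ, [X, Z]⟩`. -/
def lieDual (X : Sec E F V) (ξ : DualSec E F V) : DualSec E F V :=
  dualOfLinear
    { toFun := fun Z => der (L.rho X) (pair ξ Z) - pair ξ (L.bracket X Z)
      map_add' := fun Z Z' => by
        rw [L.bracket_add, map_add, map_add, der_add_fun]; ring
      map_smul' := fun f Z => by
        rw [L.bracket_smul, map_add, map_smul, map_smul, map_smul]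
        simp only [smul_eq_mul, der_mul, RingHom.id_apply]; ring }

/-- The Schouten bracket `[X, P]` of a section `X` with a `p`-section `P`, that is the Lie
derivative of `P` along `X`. A `p`-section is regarded as a function of `p` sections of the
dual bundle. -/
def schouten {p : ℕ} (X : Sec E F V) (P : (Fin p → DualSec E F V) → Func E M)
    (α : Fin p → DualSec E F V) : Func E M :=
  der (L.rho X) (P α) - ∑ i, P (Function.update α i (L.lieDual X (α i)))

/-- The deformed Schouten bracket `[X, P]^φ = [X, P] - (p - 1) φ(X) P` of a section `X` with a
`p`-section `P`; it is the case `r = 1` of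
`[P', P]^φ = [P', P] + (r - 1) P' ∧ ι_φ P - (-1)^(r - 1) (p - 1) (ι_φ P') ∧ P`. -/
def schoutenDef {p : ℕ} (φ : Sec E F V →ₗ[Func E M] Func E M) (X : Sec E F V)
    (P : (Fin p → DualSec E F V) → Func E M) (α : Fin p → DualSec E F V) : Func E M :=
  L.schouten X P α - ((p : ℤ) - 1) • (φ X * P α)

/-- The deformed Schouten bracket `[P, X]^φ` of a `p`-section `P` with a section `X`, which is
`-[X, P]^φ` by graded skew-symmetry. -/
def schoutenDef' {p : ℕ} (φ : Sec E F V →ₗ[Func E M] Func E M)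
    (P : (Fin p → DualSec E F V) → Func E M) (X : Sec E F V)
    (α : Fin p → DualSec E F V) : Func E M :=
  -L.schoutenDef φ X P α

/-- The deformed differential of a function as a 1-form: `(d^φ f)(X) = ρ(X) f + f φ(X)`. -/
def dFun (φ : Sec E F V →ₗ[Func E M] Func E M) (f : Func E M) :
    Sec E F V →ₗ[Func E M] Func E M where
  toFun X := der (L.rho X) f + f * φ X
  map_add' X Y := by rw [map_add, map_add, der_add]; ring
  map_smul' h X := by
    rw [map_smul, map_smul, der_smul]
    simp only [smul_eq_mul, RingHom.id_apply]; ring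

theorem dFun_eq_dDef (φ : Sec E F V →ₗ[Func E M] Func E M) (f : Func E M) (X : Sec E F V) :
    L.dFun φ f X = L.dDef φ (fun _ : Fin 0 → Sec E F V => f) ![X] := by
  simp [dFun, dDef, d, wedge, mul_comm]

end LieAlgebroid

/-- A morphism of Lie algebroids over the identity of `M`: a smooth bundle map compatible with the
anchors and the brackets. -/
structure IsLieAlgebroidHom (L : LieAlgebroid E F V) (L' : LieAlgebroid E F' W)
    (Φ : BundleMap E F V F' W) : Prop where
  anchor : ∀ X, L'.rho (homMap Φ X) = L.rho X
  bracket : ∀ X Y, homMap Φ (L.bracket X Y) = L'.bracket (homMap Φ X) (homMap Φ Y)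

/-- The dual bundle map `Φ^* : W^* → V^*`, fibrewise `η ↦ η ∘ Φ`. -/
def dualMap (Φ : BundleMap E F V F' W) :
    BundleMap E (F' →L[ℝ] ℝ) (DualBundle W) (F →L[ℝ] ℝ) (DualBundle V) :=
  ⟨fun x => ContinuousLinearMap.precomp (Trivial M ℝ x) (Φ x),
    contMDiff_hom _ fun η => contMDiff_hom _ fun s => (homMap η (homMap Φ s)).contMDiff⟩

/-! ### Generalized Lie bialgebroids -/

/-- `((A, φ₀), (A^*, X₀))` is a generalized Lie bialgebroid. Sections of `A` are regarded as
1-forms on `A^*` by evaluation, and `p`-sections of `A` as alternating `C^∞(M)`-multilinear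
functions of `p` sections of `A^*`, so that `A'.dDef (evalAt X₀)` is `d_*^{X₀}`. -/
structure IsGenLieBialgebroid (A : LieAlgebroid E F V) (φ₀ : DualSec E F V)
    (A' : LieAlgebroid E (F →L[ℝ] ℝ) (DualBundle V)) (X₀ : Sec E F V) : Prop where
  cocycle : A.IsCocycle (pair φ₀)
  dual_cocycle : A'.IsCocycle (evalAt X₀)
  compat : ∀ (X Y : Sec E F V) (α : Fin 2 → DualSec E F V),
    A'.dDef (evalAt X₀) (oneVec (A.bracket X Y)) α =
      A.schoutenDef' (pair φ₀) (A'.dDef (evalAt X₀) (oneVec X)) Y α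
        + A.schoutenDef (pair φ₀) X (A'.dDef (evalAt X₀) (oneVec Y)) α
  lie_add : ∀ (p : ℕ) (P : DualSec E F V [⋀^Fin p]→ₗ[Func E M] Func E M)
    (α : Fin p → DualSec E F V),
    A'.lieForm (evalAt X₀) φ₀ P α + A.schoutenDef (pair φ₀) X₀ P α = 0

/-- A morphism of generalized Lie bialgebroids over `M`: a Lie algebroid morphism `Φ : A → B` whose
dual `B^* → A^*` is a Lie algebroid morphism, preserving the cocycles. -/
structure IsGenLieBialgebroidHom
    (A : LieAlgebroid E F V) (φ₀ : DualSec E F V)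
    (A' : LieAlgebroid E (F →L[ℝ] ℝ) (DualBundle V)) (X₀ : Sec E F V)
    (B : LieAlgebroid E F' W) (ψ₀ : DualSec E F' W)
    (B' : LieAlgebroid E (F' →L[ℝ] ℝ) (DualBundle W)) (Y₀ : Sec E F' W)
    (Φ : BundleMap E F V F' W) : Prop where
  hom : IsLieAlgebroidHom A B Φ
  dual_hom : IsLieAlgebroidHom B' A' (dualMap Φ)
  map_section : homMap Φ X₀ = Y₀
  map_cocycle : homMap (dualMap Φ) ψ₀ = φ₀

/-- The bracket `{f, g} = ⟨d^{φ₀} f, d_*^{X₀} g⟩` induced on `C^∞(M)`. -/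
def inducedBracket (A : LieAlgebroid E F V) (φ₀ : DualSec E F V)
    (A' : LieAlgebroid E (F →L[ℝ] ℝ) (DualBundle V)) (X₀ : Sec E F V)
    (f g : Func E M) : Func E M :=
  pair (dualOfLinear (A.dFun (pair φ₀) f)) (ofBidual (A'.dFun (evalAt X₀) g))

/-! ### Jacobi structures -/

/-- A Jacobi bracket on `C^∞(M)`. -/
structure IsJacobiBracket (br : Func E M → Func E M → Func E M) : Prop where
  add_left : ∀ f g h, br (f + g) h = br f h + br g h
  smul_left : ∀ (c : ℝ) f g, br (c • f) g = c • br f g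
  skew : ∀ f g, br f g = -br g f
  mul_left : ∀ f g h, br (f * g) h = f * br g h + g * br f h - f * g * br 1 h
  jacobi : ∀ f g h, br (br f g) h + br (br g h) f + br (br h f) g = 0

variable (E M) in
/-- Bivector fields, as alternating bilinear functions of two 1-forms. -/
abbrev Bivector := DualSec E E (TangentSpace 𝓘(ℝ, E) : M → Type _) [⋀^Fin 2]→ₗ[Func E M] Func E M

variable (E M) in
/-- The tangent Lie algebroid. -/
def tangent : LieAlgebroid E E (TangentSpace 𝓘(ℝ, E) : M → Type _) where
  bracket := vbracket
  anchor := homOfLinear LinearMap.id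
  bracket_add := vbracket_add_right
  bracket_skew := vbracket_skew
  bracket_jacobi := vbracket_jacobi
  anchor_bracket X Y := by simp only [homMap_homOfLinear]; rfl
  bracket_smul X f Y := by simp only [homMap_homOfLinear]; exact vbracket_smul_right X f Y

/-- The de Rham differential `δ f` of a function. -/
def deRham (f : Func E M) : DualSec E E (TangentSpace 𝓘(ℝ, E) : M → Type _) :=
  dualOfLinear ((tangent E M).dFun 0 f)

/-- `(Λ, Z)` are the bivector field and the vector field of the bracket: `Z(f) = {1, f}` and
`Λ(δf, δg) = {f, g} - f Z(g) + g Z(f)`. -/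
structure IsJacobiPair (br : Func E M → Func E M → Func E M) (Λ : Bivector E M)
    (Z : VField E M) : Prop where
  vector : ∀ f, der Z f = br 1 f
  bivector : ∀ f g, Λ ![deRham f, deRham g] = br f g - f * der Z g + g * der Z f

/-! ### The bundles `TM × ℝ` and `T^*M × ℝ` -/

variable (E M) in
/-- The bundle `TM × ℝ`. -/
abbrev TMR : M → Type _ := (TangentSpace 𝓘(ℝ, E) : M → Type _) ×ᵇ (Trivial M ℝ)


/-- The section `(X, f)` of `TM × ℝ`. -/
def mkTMR (X : VField E M) (f : Func E M) : Sec E (E × ℝ) (TMR E M) :=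
  ⟨fun x => (X x, f x), fun x => by
    rw [contMDiffAt_section]
    have h := X.contMDiff x
    rw [contMDiffAt_section] at h
    exact h.prodMk_space (f.contMDiff x)⟩

/-- The first component of a section of `TM × ℝ`. -/
def fstTMR : Sec E (E × ℝ) (TMR E M) →ₗ[Func E M] VField E M where
  toFun s := ⟨fun x => (s x).1, fun x => by
    have h := s.contMDiff x
    rw [contMDiffAt_section] at h ⊢
    exact (ContinuousLinearMap.fst ℝ E ℝ).contMDiff.contMDiffAt.comp x h⟩
  map_add' _ _ := rfl
  map_smul' _ _ := rfl

/-- The second component of a section of `TM × ℝ`. -/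
def sndTMR : Sec E (E × ℝ) (TMR E M) →ₗ[Func E M] Func E M where
  toFun s := ⟨fun x => (s x).2, fun x => by
    have h := s.contMDiff x
    rw [contMDiffAt_section] at h
    have h' := (ContinuousLinearMap.snd ℝ E ℝ).contMDiff.contMDiffAt.comp x h
    exact h'⟩
  map_add' _ _ := rfl
  map_smul' _ _ := rfl

/-- The section `(α, f)` of `T^*M × ℝ`, the dual of `TM × ℝ`:
`⟨(α, f), (X, g)⟩ = α(X) + f g`. -/
def mkDual (α : DualSec E E (TangentSpace 𝓘(ℝ, E) : M → Type _)) (f : Func E M) :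
    DualSec E (E × ℝ) (TMR E M) :=
  dualOfLinear (pair α ∘ₗ fstTMR + f • sndTMR)

theorem pair_mkDual (α : DualSec E E (TangentSpace 𝓘(ℝ, E) : M → Type _)) (f : Func E M)
    (s : Sec E (E × ℝ) (TMR E M)) :
    pair (mkDual α f) s = pair α (fstTMR s) + f * sndTMR s := by
  rw [mkDual, pair_dualOfLinear]; rfl

variable (E M) in
/-- The Lie algebroid `TM × ℝ`, with the bracket `[(X, f), (Y, g)] = ([X, Y], X(g) - Y(f))` and the
projection to `TM` as anchor. -/
def tangentLine : LieAlgebroid E (E × ℝ) (TMR E M) where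
  bracket s t := mkTMR (vbracket (fstTMR s) (fstTMR t))
    (der (fstTMR s) (sndTMR t) - der (fstTMR t) (sndTMR s))
  anchor := homOfLinear fstTMR
  bracket_add s t u := by
    rw [map_add, map_add, vbracket_add_right, der_add_fun, der_add, add_sub_add_comm]; rfl
  bracket_skew s t := by
    rw [vbracket_skew, ← neg_sub]; rfl
  bracket_jacobi s t u := by
    have h1 (X : VField E M) (f : Func E M) : fstTMR (mkTMR X f) = X := rfl
    have h2 (X : VField E M) (f : Func E M) : sndTMR (mkTMR X f) = f := rfl
    have h3 (X Y : VField E M) (f g : Func E M) : mkTMR X f + mkTMR Y g = mkTMR (X + Y) (f + g) :=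
      rfl
    rw [h3]
    simp only [h1, h2]
    rw [vbracket_jacobi]
    congr 1
    simp only [der_sub_fun, der_vbracket]
    ring
  anchor_bracket s t := by simp only [homMap_homOfLinear]; rfl
  bracket_smul s f t := by
    simp only [homMap_homOfLinear]
    rw [map_smul, map_smul, vbracket_smul_right, der_smul, smul_eq_mul, der_mul]
    have h3 (X Y : VField E M) (f g : Func E M) : mkTMR X f + mkTMR Y g = mkTMR (X + Y) (f + g) :=
      rfl
    have h4 (X : VField E M) (f g : Func E M) : f • mkTMR X g = mkTMR (f • X) (f * g) := rfl
    have h5 : t = mkTMR (fstTMR t) (sndTMR t) := rfl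
    conv_rhs => rw [h5, h4, h4, h3]
    congr 1
    have h1 (X : VField E M) (f : Func E M) : fstTMR (mkTMR X f) = X := rfl
    have h2 (X : VField E M) (f : Func E M) : sndTMR (mkTMR X f) = f := rfl
    rw [h1, h2]
    ring

/-- The inclusion `X ↦ (X, 0)`. -/
def inlTMR : VField E M →ₗ[Func E M] Sec E (E × ℝ) (TMR E M) where
  toFun X := mkTMR X 0
  map_add' X Y := by
    conv_lhs => rw [← add_zero (0 : Func E M)]
    rfl
  map_smul' f X := by
    conv_lhs => rw [← smul_zero f]
    rfl

theorem pair_add_left (ξ η : DualSec E F V) (s : Sec E F V) :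
    pair (ξ + η) s = pair ξ s + pair η s := rfl

theorem pair_smul_left (f : Func E M) (ξ : DualSec E F V) (s : Sec E F V) :
    pair (f • ξ) s = f • pair ξ s := rfl

/-- The first component `α` of a section `(α, f)` of `T^*M × ℝ`. -/
def formPart : DualSec E (E × ℝ) (TMR E M) →ₗ[Func E M]
    DualSec E E (TangentSpace 𝓘(ℝ, E) : M → Type _) where
  toFun ξ := dualOfLinear (pair ξ ∘ₗ inlTMR)
  map_add' ξ η := dual_ext fun X => by
    rw [pair_add_left, pair_dualOfLinear, pair_dualOfLinear, pair_dualOfLinear]; rfl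
  map_smul' f ξ := dual_ext fun X => by
    rw [RingHom.id_apply, pair_smul_left, pair_dualOfLinear, pair_dualOfLinear]; rfl

theorem pair_formPart (ξ : DualSec E (E × ℝ) (TMR E M)) (X : VField E M) :
    pair (formPart ξ) X = pair ξ (mkTMR X 0) :=
  congrArg (fun T => T X) (pair_dualOfLinear (pair ξ ∘ₗ inlTMR))

/-- The second component `f` of a section `(α, f)` of `T^*M × ℝ`. -/
def funPart : DualSec E (E × ℝ) (TMR E M) →ₗ[Func E M] Func E M := evalAt (mkTMR 0 1)

/-- A section of `T^*M × ℝ` is the pair of its components. -/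
theorem mkDual_formPart_funPart (ξ : DualSec E (E × ℝ) (TMR E M)) :
    mkDual (formPart ξ) (funPart ξ) = ξ := by
  refine dual_ext fun s => ?_
  have h : s = mkTMR (fstTMR s) 0 + sndTMR s • mkTMR 0 1 := by
    have h1 : s = mkTMR (fstTMR s + sndTMR s • 0) (0 + sndTMR s * 1) := by
      rw [smul_zero, add_zero, zero_add, mul_one]; rfl
    exact h1
  rw [pair_mkDual]
  conv_rhs => rw [h, map_add, map_smul]
  rw [pair_formPart, mul_comm]
  rfl

theorem formPart_mkDual (α : DualSec E E (TangentSpace 𝓘(ℝ, E) : M → Type _)) (f : Func E M) :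
    formPart (mkDual α f) = α := by
  refine dual_ext fun X => ?_
  rw [pair_formPart, pair_mkDual]
  change pair α X + f * 0 = _
  rw [mul_zero, add_zero]

theorem funPart_mkDual (α : DualSec E E (TangentSpace 𝓘(ℝ, E) : M → Type _)) (f : Func E M) :
    funPart (mkDual α f) = f := by
  change pair (mkDual α f) (mkTMR 0 1) = _
  rw [pair_mkDual]
  change pair α 0 + f * 1 = _
  rw [map_zero, zero_add, mul_one]

/-- The linear form `Λ(α, ·)`. -/
def bivForm (Λ : Bivector E M) (α : DualSec E E (TangentSpace 𝓘(ℝ, E) : M → Type _)) :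
    DualSec E E (TangentSpace 𝓘(ℝ, E) : M → Type _) →ₗ[Func E M] Func E M where
  toFun β := Λ ![α, β]
  map_add' β γ := (Λ.curryLeft α).map_vecCons_add ![] β γ
  map_smul' f β := (Λ.curryLeft α).map_vecCons_smul ![] f β

/-- The map `♯_Λ : T^*M → TM`, `⟨β, ♯_Λ α⟩ = Λ(α, β)`. -/
def sharp (Λ : Bivector E M) :
    DualSec E E (TangentSpace 𝓘(ℝ, E) : M → Type _) →ₗ[Func E M] VField E M where
  toFun α := ofBidual (bivForm Λ α)
  map_add' α α' := sec_ext fun β => by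
    rw [map_add, pair_ofBidual, pair_ofBidual, pair_ofBidual]
    exact Λ.map_vecCons_add ![β] α α'
  map_smul' f α := sec_ext fun β => by
    rw [map_smul, pair_ofBidual, pair_ofBidual]
    exact Λ.map_vecCons_smul ![β] f α

theorem pair_sharp (Λ : Bivector E M) (α β : DualSec E E (TangentSpace 𝓘(ℝ, E) : M → Type _)) :
    pair β (sharp Λ α) = Λ ![α, β] :=
  pair_ofBidual _ β

/-- The anchor `(α, f) ↦ ♯_Λ α + f Z` of the Lie algebroid `T^*M × ℝ` of `(Λ, Z)`. -/
def jacobiAnchor (Λ : Bivector E M) (Z : VField E M) :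
    BundleMap E (E × ℝ →L[ℝ] ℝ) (DualBundle (TMR E M)) E (TangentSpace 𝓘(ℝ, E) : M → Type _) :=
  homOfLinear (sharp Λ ∘ₗ formPart + LinearMap.toSpanSingleton (Func E M) _ Z ∘ₗ funPart)

/-- The bracket of the Lie algebroid `T^*M × ℝ` of `(Λ, Z)`:
`[(α, f), (β, g)] = (L_{♯α} β - L_{♯β} α - δ(Λ(α, β)) + f L_Z β - g L_Z α - ι_Z(α ∧ β),
Λ(β, α) + ♯α(g) - ♯β(f) + f Z(g) - g Z(f))`. -/
def jacobiBracket (Λ : Bivector E M) (Z : VField E M) (ξ η : DualSec E (E × ℝ) (TMR E M)) :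
    DualSec E (E × ℝ) (TMR E M) :=
  let α := formPart ξ
  let f := funPart ξ
  let β := formPart η
  let g := funPart η
  mkDual
    ((tangent E M).lieDual (sharp Λ α) β - (tangent E M).lieDual (sharp Λ β) α
      - deRham (Λ ![α, β]) + f • (tangent E M).lieDual Z β - g • (tangent E M).lieDual Z α
      - (pair α Z • β - pair β Z • α))
    (Λ ![β, α] + der (sharp Λ α) g - der (sharp Λ β) f + f * der Z g - g * der Z f)

/-! ### The canonical map -/

/-- The bundle map `X ↦ (ρ(X), φ₀(X))` from `V` to `TM × ℝ`. -/
def canonicalMap (A : LieAlgebroid E F V) (φ₀ : DualSec E F V) :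
    BundleMap E F V (E × ℝ) (TMR E M) :=
  homOfLinear
    { toFun := fun X => mkTMR (A.rho X) (pair φ₀ X)
      map_add' := fun X Y => by rw [map_add, map_add]; rfl
      map_smul' := fun f X => by rw [map_smul, map_smul]; rfl }

theorem homMap_canonicalMap (A : LieAlgebroid E F V) (φ₀ : DualSec E F V) (X : Sec E F V) :
    homMap (canonicalMap A φ₀) X = mkTMR (A.rho X) (pair φ₀ X) := by
  rw [canonicalMap, homMap_homOfLinear]; rfl

end GLB

end

/-!
Write `d^{φ₀} f` (`LieAlgebroid.diffForm`) and `d_*^{X₀} g` (`LieAlgebroid.diffVec`) for the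
deformed differentials of functions, so that `{f, g} = ⟨d^{φ₀} f, d_*^{X₀} g⟩`.

**The induced bracket.** In degrees `p = 0, 1` the condition `L_{*φ₀}^{X₀} P + L_{X₀}^{φ₀} P = 0`
amounts to `φ₀(X₀) = 0`, `ρ_*(φ₀) = -ρ(X₀)` and `[φ₀, ξ]_* = -L_{X₀} ξ`. Comparing the
compatibility condition for `(X, f Y)` with `f` times the one for `(X, Y)` leaves an identity
`K ∧ Y = 0` valid for every section `Y`, where `K` depends only on `X` and `f`
(`IsGenLieBialgebroid.defect_mul_pair`). If the rank is at least two this forces `K = 0`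
(`defect_eq_zero`); in rank zero there is nothing to prove, and in rank one the identity is void.
Replacing `X` by `g X` in `K = 0` gives the skew-symmetry of `⟨d f, d_* g⟩`, hence of `{f, g}`.
Together with the case `p = 1` it also gives
`⟨[d^{φ₀} f, ξ]_*, X⟩ = {f, ⟨ξ, X⟩} + ⟨ξ, [d_*^{X₀} f, X]⟩` (`pair_bracket_diffForm`). For
`ξ = d^{φ₀} g`, which is `d^{φ₀}`-closed, this says that `d^{φ₀}{f, g} = [d^{φ₀} f, d^{φ₀} g]_*`
(`diffForm_inducedBracket`), and pairing with the closed section `d_*^{X₀} h` yields the Jacobi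
identity.

**The bialgebroid of a Jacobi structure.** The values at a point of the jets `jet f = (δf, f)`
exhaust the fibre of `T^*M × ℝ`, so that a `C^∞(M)`-linear map vanishing on jets is zero
(`jet_induction`). The bracket and the anchor of `T^*M × ℝ` satisfy the Leibniz rule by a direct
computation, the bracket satisfies `[jet f, jet g] = jet {f, g}`, and the anchor of `jet f` is the
Hamiltonian vector field of `f`. Compatibility with the anchor, the Jacobi identity and the cocycle
condition are tensorial once the Leibniz rule is known, and reduce to identities of the Jacobi
bracket. A section `s = (X, u)` of `TM × ℝ` acts on functions by `f ↦ ⟨jet f, s⟩ = X f + u f`, and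
the bracket of sections is the commutator of these operators. On jets, `d_*^{(-E, 0)} s` is minus
the Lie derivative of the bracket `{·, ·}` along the operator of `s`, and the compatibility
condition says that the Lie derivative along a commutator is the commutator of Lie derivatives. The
condition on `p`-sections follows from Cartan's formula (`LieAlgebroid.lieForm_eq`) and
`[(0, 1), ξ] = -L_{(-E, 0)} ξ`.

**The morphism.** The dual of the canonical map takes `jet f` to `d^{φ₀} f`, so on jets its
compatibility with the brackets is `diffForm_inducedBracket`. The invariance of the induced bracket
holds because any morphism `Φ` satisfies `Φ^*(d^{ψ₀} f) = d^{φ₀} f` and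
`Φ(d_*^{X₀} g) = d_*^{Y₀} g`.
-/

noncomputable section
namespace GLB

variable {E : Type*} [NormedAddCommGroup E] [NormedSpace ℝ E] [FiniteDimensional ℝ E]
  {M : Type*} [TopologicalSpace M] [ChartedSpace E M] [IsManifold 𝓘(ℝ, E) ∞ M] [T2Space M]
  {F : Type*} [NormedAddCommGroup F] [NormedSpace ℝ F] [FiniteDimensional ℝ F]
  {V : M → Type*} [∀ x, AddCommGroup (V x)] [∀ x, Module ℝ (V x)] [∀ x, TopologicalSpace (V x)]
  [∀ x, IsTopologicalAddGroup (V x)] [∀ x, ContinuousSMul ℝ (V x)]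
  [TopologicalSpace (TotalSpace F V)] [FiberBundle F V] [VectorBundle ℝ F V]
  [ContMDiffVectorBundle ∞ F V 𝓘(ℝ, E)]
  {F' : Type*} [NormedAddCommGroup F'] [NormedSpace ℝ F'] [FiniteDimensional ℝ F']
  {W : M → Type*} [∀ x, AddCommGroup (W x)] [∀ x, Module ℝ (W x)] [∀ x, TopologicalSpace (W x)]
  [∀ x, IsTopologicalAddGroup (W x)] [∀ x, ContinuousSMul ℝ (W x)]
  [TopologicalSpace (TotalSpace F' W)] [FiberBundle F' W] [VectorBundle ℝ F' W]
  [ContMDiffVectorBundle ∞ F' W 𝓘(ℝ, E)]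

/-! ### Functions, vector fields and their first jets -/

variable (E M) in
/-- Sections of `T^*M × ℝ`. -/
abbrev CoTMR := DualSec E (E × ℝ) (TMR E M)

theorem der_zero_fun (X : VField E M) : der X (0 : Func E M) = 0 := by
  simpa using der_sub_fun X 0 0

theorem der_neg_fun (X : VField E M) (f : Func E M) : der X (-f) = -der X f := by
  rw [← zero_sub, der_sub_fun, der_zero_fun, zero_sub]

theorem der_one (X : VField E M) : der X (1 : Func E M) = 0 := by
  have h := der_mul X 1 1
  rw [mul_one, one_mul, mul_one] at h
  exact left_eq_add.1 h

theorem der_zero (f : Func E M) : der (0 : VField E M) f = 0 := by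
  ext x; exact map_zero (mvfderiv 𝓘(ℝ, E) f x)

theorem der_neg (X : VField E M) (f : Func E M) : der (-X) f = -der X f := by
  ext x; exact map_neg (mvfderiv 𝓘(ℝ, E) f x) _

theorem der_smul_real (X : VField E M) (c : ℝ) (f : Func E M) :
    der X (c • f) = c • der X f := by
  let cc : Func E M := ⟨fun _ => c, contMDiff_const⟩
  have h0 : der X cc = 0 := by
    ext x
    exact congrArg (fun T => T (X x)) (mvfderiv_const (I := 𝓘(ℝ, E)) c (x := x))
  have h1 (g : Func E M) : c • g = cc * g := rfl
  rw [h1, der_mul, h0, zero_mul, add_zero, ← h1]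

/-- Every first jet at a point is the jet of a global function. -/
theorem exists_func_jet (x : M) (c : ℝ) (ℓ : E →L[ℝ] ℝ) :
    ∃ f : Func E M, f x = c ∧ mvfderiv 𝓘(ℝ, E) f x = ℓ := by
  let u : M → ℝ := fun y => c + ℓ (extChartAt 𝓘(ℝ, E) x y - extChartAt 𝓘(ℝ, E) x x)
  have hL : ContDiff ℝ ∞ (fun v : E => c + ℓ (v - extChartAt 𝓘(ℝ, E) x x)) := by fun_prop
  have hu : ContMDiffOn 𝓘(ℝ, E) 𝓘(ℝ, ℝ) ∞ u (chartAt E x).source :=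
    hL.contMDiff.comp_contMDiffOn (contMDiffOn_extChartAt (I := 𝓘(ℝ, E)) (n := ∞) (x := x))
  obtain ⟨s, hs⟩ := exists_section (E := E) (F := ℝ) (V := Trivial M ℝ)
    (chartAt E x).open_source (mem_chart_source E x) u (fun y hy => by
      rw [contMDiffWithinAt_section]
      simpa using hu y hy)
  have hs' : (ofTrivial s : M → ℝ) =ᶠ[𝓝 x] u := hs
  refine ⟨ofTrivial s, ?_, ?_⟩
  · rw [hs'.self_of_nhds]; simp [u]
  · have h1 : mvfderiv 𝓘(ℝ, E) (ofTrivial s) x = mvfderiv 𝓘(ℝ, E) u x := by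
      have h := hs'.mfderiv_eq (I := 𝓘(ℝ, E)) (I' := 𝓘(ℝ, ℝ))
      ext v
      exact congrArg (fun T => T v) h
    rw [h1]
    have hd : MDifferentiableAt 𝓘(ℝ, E) 𝓘(ℝ, E) (extChartAt 𝓘(ℝ, E) x) x :=
      mdifferentiableAt_extChartAt (mem_chart_source E x)
    have h2 := mvfderiv_comp (I := 𝓘(ℝ, E)) (I' := 𝓘(ℝ, E)) x
      (g := fun v : E => c + ℓ (v - extChartAt 𝓘(ℝ, E) x x))
      (hL.contMDiff.mdifferentiableAt (by simp)) hd
    refine Eq.trans h2 ?_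
    have h3 : mvfderiv 𝓘(ℝ, E) (fun v : E => c + ℓ (v - extChartAt 𝓘(ℝ, E) x x))
        (extChartAt 𝓘(ℝ, E) x x) = ℓ := by
      have h4 : HasFDerivAt (fun v : E => c + ℓ (v - extChartAt 𝓘(ℝ, E) x x)) ℓ
          (extChartAt 𝓘(ℝ, E) x x) :=
        (ℓ.hasFDerivAt.comp _ ((hasFDerivAt_id _).sub_const _)).const_add c
      have h5 := h4.hasMFDerivAt.mfderiv
      ext v
      exact congrArg (fun T => T v) h5
    rw [h3, mfderiv_extChartAt_self]
    rfl

theorem pair_deRham (f : Func E M) (X : VField E M) : pair (deRham f) X = der X f := by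
  rw [deRham, pair_dualOfLinear]
  change der (homMap (homOfLinear LinearMap.id) X) f + f * 0 = _
  rw [homMap_homOfLinear, mul_zero, add_zero, LinearMap.id_apply]

/-- The first jet `(δf, f)` of a function, as a section of `T^*M × ℝ`. -/
def jet (f : Func E M) : CoTMR E M := mkDual (deRham f) f

theorem pair_jet (f : Func E M) (s : Sec E (E × ℝ) (TMR E M)) :
    pair (jet f) s = der (fstTMR s) f + f * sndTMR s := by
  rw [jet, pair_mkDual, pair_deRham]

theorem formPart_jet (f : Func E M) : formPart (jet f) = deRham f := formPart_mkDual _ _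

theorem funPart_jet (f : Func E M) : funPart (jet f) = f := funPart_mkDual _ _

theorem pair_eq_of_eq {ξ η : DualSec E F V} {x : M} (h : ξ x = η x) (s : Sec E F V) :
    pair ξ s x = pair η s x :=
  congrArg (fun T : V x →L[ℝ] ℝ => T (s x)) h

theorem exists_jet_eq (ξ : CoTMR E M) (x : M) : ∃ f : Func E M, jet f x = ξ x := by
  let T : E × ℝ →L[ℝ] ℝ := ξ x
  obtain ⟨f, hf, hdf⟩ := exists_func_jet (E := E) x (T (0, 1))
    (T.comp (ContinuousLinearMap.inl ℝ E ℝ))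
  refine ⟨f, ContinuousLinearMap.ext fun (v : TMR E M x) => ?_⟩
  obtain ⟨s, rfl⟩ := exists_section_eq (E := E) (F := E × ℝ) (V := TMR E M) x v
  have h1 : jet f x (s x) = mvfderiv 𝓘(ℝ, E) f x (s x).1 + f x * (s x).2 :=
    congrArg (fun u : Func E M => u x) (pair_jet f s)
  refine h1.trans ?_
  rw [hdf, hf]
  have h2 : T (s x) = T ((s x).1, 0) + T ((s x).2 • ((0 : E), (1 : ℝ))) := by
    rw [← map_add]
    congr 1
    refine Prod.ext ?_ ?_
    · have h0 (a : E) (r : ℝ) : a = a + r • (0 : E) := by rw [smul_zero, add_zero]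
      exact h0 _ _
    · change (s x).2 = 0 + (s x).2 * 1
      ring
  refine Eq.trans ?_ h2.symm
  rw [map_smul, mul_comm]
  rfl

/-- A `C^∞(M)`-linear map on the sections of `T^*M × ℝ` vanishes if it vanishes on jets. -/
theorem jet_induction (T : CoTMR E M → Sec E F V) (hadd : ∀ ξ η, T (ξ + η) = T ξ + T η)
    (hsmul : ∀ (f : Func E M) ξ, T (f • ξ) = f • T ξ) (hjet : ∀ f, T (jet f) = 0)
    (ξ : CoTMR E M) : T ξ = 0 := by
  let T' : CoTMR E M →ₗ[Func E M] Sec E F V := ⟨⟨T, hadd⟩, hsmul⟩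
  ext x
  obtain ⟨f, hf⟩ := exists_jet_eq ξ x
  have h : T' ξ x = T' (jet f) x := tensorial_eq T' hf.symm
  refine h.trans ?_
  have h' : T' (jet f) = 0 := hjet f
  rw [h']

/-- The case of `jet_induction` for maps with values in `C^∞(M)`. -/
theorem jet_induction_fun (T : CoTMR E M → Func E M) (hadd : ∀ ξ η, T (ξ + η) = T ξ + T η)
    (hsmul : ∀ (f : Func E M) ξ, T (f • ξ) = f * T ξ) (hjet : ∀ f, T (jet f) = 0)
    (ξ : CoTMR E M) : T ξ = 0 :=
  ofTrivial.symm.injective ((jet_induction (fun ξ => ofTrivial.symm (T ξ))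
    (fun ξ η => by rw [hadd, map_add]) (fun f ξ => by rw [hsmul, ← smul_eq_mul, map_smul])
    (fun f => by rw [hjet, map_zero]) ξ).trans (map_zero _).symm)

/-- Every covector at a point is the differential of a global function. -/
theorem exists_deRham_eq (α : DualSec E E (TangentSpace 𝓘(ℝ, E) : M → Type _)) (x : M) :
    ∃ f : Func E M, deRham f x = α x := by
  obtain ⟨f, -, hdf⟩ := exists_func_jet (E := E) x 0 (α x)
  refine ⟨f, ContinuousLinearMap.ext fun (v : TangentSpace 𝓘(ℝ, E) x) => ?_⟩
  obtain ⟨s, rfl⟩ := exists_section_eq (E := E) (F := E)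
    (V := (TangentSpace 𝓘(ℝ, E) : M → Type _)) x v
  have h1 : deRham f x (s x) = mvfderiv 𝓘(ℝ, E) f x (s x) :=
    congrArg (fun u : Func E M => u x) (pair_deRham f s)
  rw [h1, hdf]

/-- Vector fields are determined by their action on functions. -/
theorem vfield_ext {X Y : VField E M} (h : ∀ f, der X f = der Y f) : X = Y := by
  refine sec_ext fun α => ?_
  ext x
  obtain ⟨f, hf⟩ := exists_deRham_eq α x
  rw [← pair_eq_of_eq hf, ← pair_eq_of_eq hf, pair_deRham, pair_deRham, h]

/-! ### Cartan's formula -/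

theorem map_vecCons_swap {k : ℕ} {R N N' : Type*} [CommRing R] [AddCommGroup N] [Module R N]
    [AddCommGroup N'] [Module R N'] (P : N [⋀^Fin (k + 2)]→ₗ[R] N') (a b : N) (v : Fin k → N) :
    P (Matrix.vecCons a (Matrix.vecCons b v)) = -P (Matrix.vecCons b (Matrix.vecCons a v)) := by
  have h := P.map_insertNth 1 b (Matrix.vecCons a v)
  have h1 : (1 : Fin (k + 2)).insertNth b (Matrix.vecCons a v)
      = Matrix.vecCons a (Matrix.vecCons b v) := by
    rw [← Fin.succ_zero_eq_one]
    exact (Fin.insertNth_succ_cons 0 b a v).trans (by rw [Fin.insertNth_zero]; rfl)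
  rw [← h1, h]
  simp

theorem map_vecCons_removeNth {k : ℕ} {R N N' : Type*} [CommRing R] [AddCommGroup N] [Module R N]
    [AddCommGroup N'] [Module R N'] (P : N [⋀^Fin (k + 1)]→ₗ[R] N') (j : Fin (k + 1)) (a : N)
    (Y : Fin (k + 1) → N) :
    (-1) ^ (j : ℕ) • P (Matrix.vecCons a (j.removeNth Y)) = P (Function.update Y j a) := by
  rw [← Fin.insertNth_removeNth, P.map_insertNth]

theorem removeNth_succ_vecCons {k : ℕ} {N : Type*} (i : Fin (k + 1)) (a : N)
    (Y : Fin (k + 1) → N) :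
    i.succ.removeNth (Matrix.vecCons a Y) = Matrix.vecCons a (i.removeNth Y) := by
  funext j
  refine Fin.cases ?_ (fun j => ?_) j
  · simp [Fin.removeNth]
  · simp [Fin.removeNth]

theorem removeNth_zero_vecCons {k : ℕ} {N : Type*} (a : N) (Y : Fin k → N) :
    (0 : Fin (k + 1)).removeNth (Matrix.vecCons a Y) = Y := by
  funext j
  simp [Fin.removeNth]

theorem sum_Ici_succ {k : ℕ} {R : Type*} [AddCommMonoid R] (i : Fin k) (u : Fin (k + 1) → R) :
    ∑ j ∈ Finset.Ici i.succ, u j = ∑ j ∈ Finset.Ici i, u j.succ := by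
  rw [← Fin.map_succEmb_Ici, Finset.sum_map]
  rfl

namespace LieAlgebroid

variable (L : LieAlgebroid E F V) (φ : Sec E F V →ₗ[Func E M] Func E M)

theorem wedge_vecCons {k : ℕ} (θ : (Fin (k + 1) → Sec E F V) → Func E M) (X : Sec E F V)
    (Y : Fin (k + 1) → Sec E F V) :
    wedge φ θ (Matrix.vecCons X Y) = φ X * θ Y - wedge φ (contract X θ) Y := by
  rw [wedge, Fin.sum_univ_succ, wedge, removeNth_zero_vecCons, sub_eq_add_neg,
    ← Finset.sum_neg_distrib]
  congr 1
  · simp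
  · refine Finset.sum_congr rfl fun i _ => ?_
    rw [removeNth_succ_vecCons, contract, Fin.val_succ, pow_succ]
    simp

/-- Cartan's formula `ι_X d P = L_X P - d ι_X P`. -/
theorem d_vecCons {k : ℕ} (P : Sec E F V [⋀^Fin (k + 1)]→ₗ[Func E M] Func E M) (X : Sec E F V)
    (Y : Fin (k + 1) → Sec E F V) :
    L.d P (Matrix.vecCons X Y) = der (L.rho X) (P Y)
      - ∑ i, P (Function.update Y i (L.bracket X (Y i))) - L.d (contract X P) Y := by
  let g (i j : Fin (k + 1)) : Func E M := (-1) ^ ((i : ℕ) + (j : ℕ)) *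
    P (Matrix.vecCons (L.bracket (Matrix.vecCons X Y i.castSucc) (Matrix.vecCons X Y j.succ))
      (j.removeNth (i.castSucc.removeNth (Matrix.vecCons X Y))))
  have hg : ∑ i, ∑ j ∈ Finset.Ici i, g i j = ∑ j ∈ Finset.Ici 0, g 0 j
      + ∑ i : Fin k, ∑ j ∈ Finset.Ici i.succ, g i.succ j := Fin.sum_univ_succ _
  rw [d, Fin.sum_univ_succ, removeNth_zero_vecCons, hg]
  have hbr : ∑ j ∈ Finset.Ici (0 : Fin (k + 1)), g 0 j
      = ∑ i, P (Function.update Y i (L.bracket X (Y i))) := by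
    have : Finset.Ici (0 : Fin (k + 1)) = Finset.univ := by ext; simp
    rw [this]
    refine Finset.sum_congr rfl fun j _ => ?_
    rw [← map_vecCons_removeNth]
    simp [g]
  rw [hbr]
  cases k with
  | zero =>
    have hr : Fin.removeNth 1 (Matrix.vecCons X Y) = ![X] := by
      funext j; fin_cases j; rfl
    simp [d, contract, hr]
    ring
  | succ k =>
    rw [d]
    have h1 : ∀ i : Fin (k + 2), (-1 : Func E M) ^ (i.succ : ℕ) *
        der (L.rho (Matrix.vecCons X Y i.succ)) (P (i.succ.removeNth (Matrix.vecCons X Y)))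
        = -((-1) ^ (i : ℕ) * der (L.rho (Y i)) (contract X P (i.removeNth Y))) := fun i => by
      rw [removeNth_succ_vecCons, contract, Fin.val_succ, pow_succ]
      simp
    have h2 : ∀ i : Fin (k + 1), (∑ j ∈ Finset.Ici i.succ, g i.succ j)
        = -∑ j ∈ Finset.Ici i, (-1) ^ ((i : ℕ) + (j : ℕ)) *
          contract X P (Matrix.vecCons (L.bracket (Y i.castSucc) (Y j.succ))
            (j.removeNth (i.castSucc.removeNth Y))) := fun i => by
      rw [sum_Ici_succ, ← Finset.sum_neg_distrib]
      refine Finset.sum_congr rfl fun j _ => ?_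
      simp only [g]
      rw [← Fin.succ_castSucc, removeNth_succ_vecCons, removeNth_succ_vecCons, contract,
        map_vecCons_swap]
      simp only [Matrix.cons_val_succ, Fin.val_succ]
      ring
    rw [Finset.sum_congr rfl fun i _ => h1 i, Finset.sum_congr rfl fun i _ => h2 i,
      Finset.sum_neg_distrib, Finset.sum_neg_distrib]
    simp only [Matrix.cons_val_zero, Fin.val_zero, pow_zero, one_mul]
    ring

/-- Cartan's formula for the deformed Lie derivative of forms. -/
theorem lieForm_eq {p : ℕ} (X : Sec E F V) (P : Sec E F V [⋀^Fin p]→ₗ[Func E M] Func E M)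
    (Y : Fin p → Sec E F V) :
    L.lieForm φ X P Y = der (L.rho X) (P Y) + φ X * P Y
      - ∑ i, P (Function.update Y i (L.bracket X (Y i))) := by
  cases p with
  | zero =>
    simp [lieForm, contract, dDef, d, wedge, Subsingleton.elim Y ![]]
  | succ p =>
    rw [lieForm, dDef, contract, dDef, d_vecCons, wedge_vecCons]
    ring

end LieAlgebroid

/-! ### Differentials and Lie derivatives of low degree -/

namespace LieAlgebroid

section General

variable (L : LieAlgebroid E F V) (φ : Sec E F V →ₗ[Func E M] Func E M)

theorem bracket_smul_left (f : Func E M) (X Y : Sec E F V) :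
    L.bracket (f • X) Y = f • L.bracket X Y - der (L.rho Y) f • X := by
  rw [L.bracket_skew, L.bracket_smul, L.bracket_skew Y X, smul_neg, neg_add, neg_neg,
    sub_eq_add_neg]

theorem rho_bracket (X Y : Sec E F V) :
    L.rho (L.bracket X Y) = vbracket (L.rho X) (L.rho Y) := L.anchor_bracket X Y

theorem dFun_apply (f : Func E M) (X : Sec E F V) :
    L.dFun φ f X = der (L.rho X) f + f * φ X := rfl

/-- `d^φ ∘ d^φ = 0` on functions. -/
theorem dFun_bracket (hφ : L.IsCocycle φ) (f : Func E M) (X Y : Sec E F V) :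
    L.dFun φ f (L.bracket X Y) = der (L.rho X) (L.dFun φ f Y) + φ X * L.dFun φ f Y
      - (der (L.rho Y) (L.dFun φ f X) + φ Y * L.dFun φ f X) := by
  simp only [dFun_apply]
  rw [hφ, L.rho_bracket, der_vbracket]
  simp only [der_add_fun, der_mul]
  ring

theorem dDef_two (θ : (Fin 1 → Sec E F V) → Func E M) (X Y : Sec E F V) :
    L.dDef φ θ ![X, Y] = der (L.rho X) (θ ![Y]) - der (L.rho Y) (θ ![X])
      - θ ![L.bracket X Y] + φ X * θ ![Y] - φ Y * θ ![X] := by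
  have h0 : Fin.removeNth 0 ![X, Y] = ![Y] := removeNth_zero_vecCons X ![Y]
  have h1 : Fin.removeNth 1 ![X, Y] = ![X] := by funext j; fin_cases j; rfl
  have h2 (a : Sec E F V) (u : Fin 0 → Sec E F V) : Matrix.vecCons a u = ![a] := by
    rw [Subsingleton.elim u ![]]
  simp [dDef, d, wedge, Fin.sum_univ_two, h0, h1, h2]
  ring

theorem schoutenDef_two (P : (Fin 2 → DualSec E F V) → Func E M) (X : Sec E F V)
    (ξ η : DualSec E F V) :
    L.schoutenDef φ X P ![ξ, η] = der (L.rho X) (P ![ξ, η])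
      - (P ![L.lieDual X ξ, η] + P ![ξ, L.lieDual X η]) - φ X * P ![ξ, η] := by
  have h0 (a : DualSec E F V) : Function.update ![ξ, η] 0 a = ![a, η] := by
    funext j; fin_cases j <;> rfl
  have h1 (a : DualSec E F V) : Function.update ![ξ, η] 1 a = ![ξ, a] := by
    funext j; fin_cases j <;> rfl
  simp [schoutenDef, schouten, Fin.sum_univ_two, h0, h1]

theorem pair_lieDual (X : Sec E F V) (ξ : DualSec E F V) (Z : Sec E F V) :
    pair (L.lieDual X ξ) Z = der (L.rho X) (pair ξ Z) - pair ξ (L.bracket X Z) := by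
  rw [lieDual, pair_dualOfLinear]; rfl

/-- The deformed differential `d^φ f` as a section of the dual bundle. -/
def diffForm (f : Func E M) : DualSec E F V := dualOfLinear (L.dFun φ f)

theorem pair_diffForm (f : Func E M) (X : Sec E F V) :
    pair (L.diffForm φ f) X = der (L.rho X) f + f * φ X := by
  rw [diffForm, pair_dualOfLinear]; rfl

theorem lieDual_smul_left (f : Func E M) (X : Sec E F V) (ξ : DualSec E F V) :
    L.lieDual (f • X) ξ = f • L.lieDual X ξ + pair ξ X • L.diffForm 0 f := by
  refine dual_ext fun Z => ?_
  rw [pair_add_left, pair_smul_left, pair_smul_left, pair_lieDual, pair_lieDual, pair_diffForm,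
    bracket_smul_left, map_sub, map_smul, map_smul, map_smul, der_smul]
  simp only [smul_eq_mul, LinearMap.zero_apply]
  ring

theorem lieDual_smul (f : Func E M) (X : Sec E F V) (ξ : DualSec E F V) :
    L.lieDual X (f • ξ) = f • L.lieDual X ξ + der (L.rho X) f • ξ := by
  refine dual_ext fun Z => ?_
  rw [pair_add_left, pair_smul_left, pair_smul_left, pair_lieDual, pair_lieDual, pair_smul_left,
    pair_smul_left]
  simp only [smul_eq_mul, der_mul]
  ring

theorem lieDual_add (X : Sec E F V) (ξ η : DualSec E F V) :
    L.lieDual X (ξ + η) = L.lieDual X ξ + L.lieDual X η := by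
  refine dual_ext fun Z => ?_
  simp only [pair_add_left, pair_lieDual, der_add_fun]
  ring

end General

section Dual

variable (A : LieAlgebroid E F V) (A' : LieAlgebroid E (F →L[ℝ] ℝ) (DualBundle V))
  (θ : DualSec E F V →ₗ[Func E M] Func E M) (X₀ : Sec E F V)

/-- For a Lie algebroid structure on the dual bundle, the deformed differential `d_*^θ f` as a
section of the bundle itself. -/
def diffVec (f : Func E M) : Sec E F V := ofBidual (A'.dFun θ f)

theorem pair_diffVec (f : Func E M) (ξ : DualSec E F V) :
    pair ξ (A'.diffVec θ f) = der (A'.rho ξ) f + f * θ ξ := pair_ofBidual _ ξ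

/-- The value at `(ξ, η)` of `d_*^{X₀} X`, for a Lie algebroid structure on the dual bundle. -/
def dVec (X : Sec E F V) (ξ η : DualSec E F V) : Func E M :=
  A'.dDef (evalAt X₀) (oneVec X) ![ξ, η]

theorem dVec_eq (X : Sec E F V) (ξ η : DualSec E F V) :
    A'.dVec X₀ X ξ η = der (A'.rho ξ) (pair η X) - der (A'.rho η) (pair ξ X)
      - pair (A'.bracket ξ η) X + pair ξ X₀ * pair η X - pair η X₀ * pair ξ X :=
  A'.dDef_two (evalAt X₀) (oneVec X) ξ η

theorem dVec_skew (X : Sec E F V) (ξ η : DualSec E F V) :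
    A'.dVec X₀ X ξ η = -A'.dVec X₀ X η ξ := by
  have h : pair (-A'.bracket η ξ) X = -pair (A'.bracket η ξ) X := rfl
  rw [dVec_eq, dVec_eq, A'.bracket_skew ξ η, h]
  ring

theorem dVec_add_right (X : Sec E F V) (ξ η ζ : DualSec E F V) :
    A'.dVec X₀ X ξ (η + ζ) = A'.dVec X₀ X ξ η + A'.dVec X₀ X ξ ζ := by
  simp only [dVec_eq, map_add, pair_add_left, der_add, der_add_fun, A'.bracket_add]
  ring

theorem dVec_smul_right (X : Sec E F V) (f : Func E M) (ξ η : DualSec E F V) :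
    A'.dVec X₀ X ξ (f • η) = f * A'.dVec X₀ X ξ η := by
  simp only [dVec_eq, map_smul, pair_smul_left, pair_add_left, der_smul, A'.bracket_smul,
    smul_eq_mul, der_mul]
  ring

theorem dVec_add_left (X : Sec E F V) (ξ η ζ : DualSec E F V) :
    A'.dVec X₀ X (ξ + η) ζ = A'.dVec X₀ X ξ ζ + A'.dVec X₀ X η ζ := by
  rw [dVec_skew, dVec_add_right, neg_add, ← dVec_skew, ← dVec_skew]

theorem dVec_smul_left (X : Sec E F V) (f : Func E M) (ξ η : DualSec E F V) :
    A'.dVec X₀ X (f • ξ) η = f * A'.dVec X₀ X ξ η := by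
  rw [dVec_skew, dVec_smul_right, ← mul_neg, ← dVec_skew]

theorem dVec_add_vec (X Y : Sec E F V) (ξ η : DualSec E F V) :
    A'.dVec X₀ (X + Y) ξ η = A'.dVec X₀ X ξ η + A'.dVec X₀ Y ξ η := by
  simp only [dVec_eq, map_add, der_add_fun]
  ring

/-- `d_*^{X₀}(f X) = f d_*^{X₀} X + d_* f ∧ X`. -/
theorem dVec_smul_vec (f : Func E M) (X : Sec E F V) (ξ η : DualSec E F V) :
    A'.dVec X₀ (f • X) ξ η = f * A'.dVec X₀ X ξ η + der (A'.rho ξ) f * pair η X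
      - der (A'.rho η) f * pair ξ X := by
  simp only [dVec_eq, map_smul, smul_eq_mul, der_mul]
  ring

end Dual

end LieAlgebroid

/-! ### The induced bracket of a generalized Lie bialgebroid -/

theorem pair_eq_zero_of_finrank (hF : Module.finrank ℝ F = 0) (ξ : DualSec E F V)
    (X : Sec E F V) : pair ξ X = 0 := by
  ext x
  have : Subsingleton F := Module.finrank_zero_iff.1 hF
  have : Subsingleton (V x) :=
    ((trivializationAt F V x).continuousLinearEquivAt ℝ x
      (FiberBundle.mem_baseSet_trivializationAt' x)).toEquiv.subsingleton
  change ξ x (X x) = 0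
  rw [Subsingleton.elim (X x) 0]
  exact map_zero (ξ x : V x →L[ℝ] ℝ)

/-- In rank at least two, every covector at a point annihilates a section that does not vanish
there. -/
theorem exists_pair_eq_one (hF : 1 < Module.finrank ℝ F) (ξ : DualSec E F V) (x : M) :
    ∃ (Y : Sec E F V) (η : DualSec E F V), pair ξ Y x = 0 ∧ pair η Y x = 1 := by
  have : T2Space (V x) := FiberBundle.t2Space F V x
  have : FiniteDimensional ℝ (V x) := VectorBundle.finiteDimensional ℝ F V x
  have hV : Module.finrank ℝ (V x) = Module.finrank ℝ F :=
    ((trivializationAt F V x).continuousLinearEquivAt ℝ x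
      (FiberBundle.mem_baseSet_trivializationAt' x)).toLinearEquiv.finrank_eq
  have hker : LinearMap.ker ((ξ x : V x →L[ℝ] ℝ) : V x →ₗ[ℝ] ℝ) ≠ ⊥ :=
    LinearMap.ker_ne_bot_of_finrank_lt (by rw [hV, Module.finrank_self]; exact hF)
  obtain ⟨v, hv, hv0⟩ := Submodule.exists_mem_ne_zero_of_ne_bot hker
  obtain ⟨α, hα⟩ : ∃ α : Module.Dual ℝ (V x), α v = 1 := by
    obtain ⟨β, hβ⟩ : ∃ β : Module.Dual ℝ (V x), β v ≠ 0 := by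
      by_contra! h
      exact hv0 ((Module.forall_dual_apply_eq_zero_iff ℝ v).1 h)
    exact ⟨(β v)⁻¹ • β, inv_mul_cancel₀ hβ⟩
  obtain ⟨Y, hY⟩ := exists_section_eq (E := E) (F := F) x v
  obtain ⟨η, hη⟩ := exists_section_eq (E := E) (F := F →L[ℝ] ℝ) (V := DualBundle V) x
    (LinearMap.toContinuousLinearMap α : V x →L[ℝ] ℝ)
  refine ⟨Y, η, ?_, ?_⟩
  · change ξ x (Y x) = 0
    rw [hY]; exact hv
  · change η x (Y x) = 1
    rw [hη, hY]; exact hα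

section InducedBracket

open LieAlgebroid

variable {A : LieAlgebroid E F V} {φ₀ : DualSec E F V}
  {A' : LieAlgebroid E (F →L[ℝ] ℝ) (DualBundle V)} {X₀ : Sec E F V}

theorem inducedBracket_eq_left (f g : Func E M) :
    inducedBracket A φ₀ A' X₀ f g = der (A.rho (A'.diffVec (evalAt X₀) g)) f
      + f * pair φ₀ (A'.diffVec (evalAt X₀) g) := A.pair_diffForm (pair φ₀) f _

theorem inducedBracket_eq_right (f g : Func E M) :
    inducedBracket A φ₀ A' X₀ f g = der (A'.rho (A.diffForm (pair φ₀) f)) g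
      + g * pair (A.diffForm (pair φ₀) f) X₀ := A'.pair_diffVec (evalAt X₀) g _

theorem inducedBracket_neg (f g : Func E M) :
    inducedBracket A φ₀ A' X₀ f (-g) = -inducedBracket A φ₀ A' X₀ f g := by
  rw [inducedBracket_eq_right, inducedBracket_eq_right, der_neg_fun]
  ring

theorem diffForm_eq (f : Func E M) :
    A.diffForm (pair φ₀) f = A.diffForm 0 f + f • φ₀ := by
  refine dual_ext fun X => ?_
  rw [pair_add_left, pair_smul_left, pair_diffForm, pair_diffForm, LinearMap.zero_apply, mul_zero,
    add_zero, smul_eq_mul]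

namespace IsGenLieBialgebroid

variable (hA : IsGenLieBialgebroid A φ₀ A' X₀)
include hA

theorem pair_cocycles : pair φ₀ X₀ = 0 := by
  -- For the function `1`, the condition in degree zero reads `2 φ₀(X₀) = 0`.
  have h := hA.lie_add 0 (AlternatingMap.constOfIsEmpty _ _ _ 1) ![]
  rw [lieForm_eq] at h
  simp only [schoutenDef, schouten, AlternatingMap.constOfIsEmpty_apply, Function.const_apply,
    der_one, Finset.univ_eq_empty, Finset.sum_empty] at h
  have h2 : pair φ₀ X₀ + pair φ₀ X₀ = 0 := by
    refine Eq.trans ?_ h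
    change _ = 0 + pair φ₀ X₀ * 1 - 0 + (0 - 0 - _)
    simp
  ext x
  have h3 : pair φ₀ X₀ x + pair φ₀ X₀ x = 0 := congrArg (fun u : Func E M => u x) h2
  change pair φ₀ X₀ x = 0
  linarith

theorem der_rho_cocycle (f : Func E M) : der (A'.rho φ₀) f = -der (A.rho X₀) f := by
  have h := hA.lie_add 0 (AlternatingMap.constOfIsEmpty _ _ _ f) ![]
  rw [lieForm_eq] at h
  have h1 : (evalAt X₀ φ₀ : Func E M) = 0 := hA.pair_cocycles
  rw [h1] at h
  simp only [schoutenDef, schouten, AlternatingMap.constOfIsEmpty_apply, Function.const_apply,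
    hA.pair_cocycles, Finset.univ_eq_empty, Finset.sum_empty, zero_mul, smul_zero] at h
  rw [eq_neg_iff_add_eq_zero, ← h]
  ring

/-- The condition on `p`-sections for `p = 1`. -/
theorem bracket_cocycle (ξ : DualSec E F V) : A'.bracket φ₀ ξ = -A.lieDual X₀ ξ := by
  refine dual_ext fun X => ?_
  have h := hA.lie_add 1 (AlternatingMap.ofSubsingleton _ _ _ (0 : Fin 1) (evalAt X)) ![ξ]
  rw [lieForm_eq] at h
  have h1 : (evalAt X₀ φ₀ : Func E M) = 0 := hA.pair_cocycles
  rw [h1] at h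
  simp [schoutenDef, schouten, hA.pair_cocycles, hA.der_rho_cocycle] at h
  change -der (A.rho X₀) (pair ξ X) - pair (A'.bracket φ₀ ξ) X
    + (der (A.rho X₀) (pair ξ X) - pair (A.lieDual X₀ ξ) X) = 0 at h
  change pair (A'.bracket φ₀ ξ) X = -pair (A.lieDual X₀ ξ) X
  linear_combination -h

/-- Compatibility, evaluated on a pair of sections of the dual bundle. -/
theorem dVec_bracket (X Y : Sec E F V) (ξ η : DualSec E F V) :
    A'.dVec X₀ (A.bracket X Y) ξ η =
      -(der (A.rho Y) (A'.dVec X₀ X ξ η) - (A'.dVec X₀ X (A.lieDual Y ξ) η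
          + A'.dVec X₀ X ξ (A.lieDual Y η)) - pair φ₀ Y * A'.dVec X₀ X ξ η)
      + (der (A.rho X) (A'.dVec X₀ Y ξ η) - (A'.dVec X₀ Y (A.lieDual X ξ) η
          + A'.dVec X₀ Y ξ (A.lieDual X η)) - pair φ₀ X * A'.dVec X₀ Y ξ η) := by
  have h := hA.compat X Y ![ξ, η]
  rw [schoutenDef', schoutenDef_two, schoutenDef_two] at h
  exact h

/-- Compatibility for `(X, f Y)` minus `f` times compatibility for `(X, Y)`: it has the form
`K ∧ Y = 0` for a section `K` determined by `X` and `f`, evaluated at `(ξ, η)`. -/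
theorem defect_mul_pair (X Y : Sec E F V) (f : Func E M) (ξ η : DualSec E F V) :
    (der (A'.rho ξ) (der (A.rho X) f) - der (A.rho X) (der (A'.rho ξ) f)
        + der (A'.rho (A.lieDual X ξ)) f + pair φ₀ X * der (A'.rho ξ) f
        + A'.dVec X₀ X (A.diffForm 0 f) ξ) * pair η Y =
    (der (A'.rho η) (der (A.rho X) f) - der (A.rho X) (der (A'.rho η) f)
        + der (A'.rho (A.lieDual X η)) f + pair φ₀ X * der (A'.rho η) f
        + A'.dVec X₀ X (A.diffForm 0 f) η) * pair ξ Y := by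
  have h0 := hA.dVec_bracket X Y ξ η
  have h1 := hA.dVec_bracket X (f • Y) ξ η
  rw [A.bracket_smul, dVec_add_vec] at h1
  simp only [dVec_smul_vec, lieDual_smul_left, dVec_add_left, dVec_add_right, dVec_smul_left,
    dVec_smul_right, map_smul, der_smul, der_add_fun, der_sub_fun, der_mul, smul_eq_mul,
    pair_lieDual] at h1
  rw [dVec_skew A' X₀ X ξ (A.diffForm 0 f)] at h1
  linear_combination h1 - f * h0

section Rank

variable (hF : Module.finrank ℝ F ≠ 1)
include hF

/-- The relation `L_{*δf} X = [X, d_* f]`, up to terms in `φ₀` and `X₀`, paired with `ξ`. The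
rank enters here: `K ∧ Y = 0` for every `Y` implies `K = 0` unless the rank is one. -/
theorem defect_eq_zero (X : Sec E F V) (f : Func E M) (ξ : DualSec E F V) :
    der (A'.rho ξ) (der (A.rho X) f) - der (A.rho X) (der (A'.rho ξ) f)
        + der (A'.rho (A.lieDual X ξ)) f + pair φ₀ X * der (A'.rho ξ) f
        + A'.dVec X₀ X (A.diffForm 0 f) ξ = 0 := by
  rcases Nat.lt_or_gt_of_ne hF with h | h
  · have h0 := pair_eq_zero_of_finrank (E := E) (V := V) (Nat.lt_one_iff.1 h)
    have h1 (η : DualSec E F V) : η = 0 := dual_ext fun s => by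
      rw [h0]; rfl
    have hX : X = 0 := sec_ext fun η => by rw [h0, h0]
    simp only [dVec_eq, h0, h1 ξ, h1 (A.lieDual X 0), map_zero, der_zero, der_zero_fun]
    simp
  · ext x
    obtain ⟨Y, η, hY, hη⟩ := exists_pair_eq_one (E := E) h ξ x
    have h1 := congrArg (fun u : Func E M => u x) (hA.defect_mul_pair X Y f ξ η)
    simp only [ContMDiffMap.coe_mul, Pi.mul_apply, hY, hη, mul_one, mul_zero] at h1
    exact h1

/-- Skew-symmetry of `⟨d f, d_* g⟩ = ρ_*(d f) g`. -/
theorem der_diffForm_skew (f g : Func E M) :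
    der (A'.rho (A.diffForm 0 g)) f = -der (A'.rho (A.diffForm 0 f)) g := by
  rw [eq_neg_iff_add_eq_zero]
  -- The relation `defect_eq_zero` for `g X`, minus `g` times the one for `X`.
  have key (X : Sec E F V) (ξ : DualSec E F V) :
      (der (A'.rho (A.diffForm 0 g)) f + der (A'.rho (A.diffForm 0 f)) g) * pair ξ X = 0 := by
    have h0 := hA.defect_eq_zero hF X f ξ
    have h1 := hA.defect_eq_zero hF (g • X) f ξ
    simp only [dVec_smul_vec, lieDual_smul_left, map_add, map_smul, der_add, der_smul, der_mul,
      pair_diffForm, LinearMap.zero_apply, mul_zero, add_zero, smul_eq_mul] at h1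
    linear_combination h1 - g * h0
  rcases Nat.lt_or_gt_of_ne hF with h | h
  · have h0 := pair_eq_zero_of_finrank (E := E) (V := V) (Nat.lt_one_iff.1 h)
    have h1 (η : DualSec E F V) : η = 0 := dual_ext fun s => by
      rw [h0]; rfl
    rw [h1 (A.diffForm 0 g), h1 (A.diffForm 0 f), map_zero, der_zero, der_zero, add_zero]
  · ext x
    obtain ⟨Y, η, -, hη⟩ := exists_pair_eq_one (E := E) h φ₀ x
    have h1 := congrArg (fun u : Func E M => u x) (key Y η)
    simp only [ContMDiffMap.coe_mul, Pi.mul_apply, hη, mul_one] at h1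
    exact h1

theorem inducedBracket_eq (f g : Func E M) :
    inducedBracket A φ₀ A' X₀ f g = der (A'.rho (A.diffForm 0 f)) g
      + g * der (A.rho X₀) f - f * der (A.rho X₀) g := by
  rw [inducedBracket_eq_right, pair_diffForm, diffForm_eq, map_add, map_smul, der_add, der_smul,
    hA.der_rho_cocycle, hA.pair_cocycles]
  ring

theorem inducedBracket_skew (f g : Func E M) :
    inducedBracket A φ₀ A' X₀ f g = -inducedBracket A φ₀ A' X₀ g f := by
  rw [hA.inducedBracket_eq hF, hA.inducedBracket_eq hF, hA.der_diffForm_skew hF]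
  ring

/-- The deformed identity `L_{*ξ}^{X₀} X = [X, d_*^{X₀} f]` for `ξ = d^{φ₀} f`. -/
theorem pair_bracket_diffForm (X : Sec E F V) (f : Func E M) (ξ : DualSec E F V) :
    pair (A'.bracket (A.diffForm (pair φ₀) f) ξ) X = inducedBracket A φ₀ A' X₀ f (pair ξ X)
      + pair ξ (A.bracket (A'.diffVec (evalAt X₀) f) X) := by
  have h0 := hA.defect_eq_zero hF X f ξ
  have hc : pair (A'.bracket φ₀ ξ) X = -pair (A.lieDual X₀ ξ) X :=
    congrArg (fun η => pair η X) (hA.bracket_cocycle ξ)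
  have h1 : A'.dVec X₀ X (A.diffForm (pair φ₀) f) ξ
      = A'.dVec X₀ X (A.diffForm 0 f) ξ + f * A'.dVec X₀ X φ₀ ξ := by
    rw [diffForm_eq, dVec_add_left, dVec_smul_left]
  have h2 := dVec_eq A' X₀ X (A.diffForm (pair φ₀) f) ξ
  have h3 := dVec_eq A' X₀ X φ₀ ξ
  rw [hc, pair_lieDual, hA.pair_cocycles, hA.der_rho_cocycle, A.bracket_skew X₀, map_neg] at h3
  have h4 := A.pair_lieDual X ξ (A'.diffVec (evalAt X₀) f)
  have h5 := A.pair_lieDual X ξ X₀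
  simp only [pair_diffVec, der_add_fun, der_mul] at h4
  change _ + f * pair (A.lieDual X ξ) X₀ = der (A.rho X) (der (A'.rho ξ) f)
    + (f * der (A.rho X) (pair ξ X₀) + der (A.rho X) f * pair ξ X₀) - _ at h4
  rw [pair_diffForm, der_add_fun, der_mul] at h2
  rw [inducedBracket_eq_right, A.bracket_skew, map_neg]
  linear_combination -h0 - h1 + h2 - f * h3 + h4 - f * h5

/-- `d^{φ₀}` takes the induced bracket to the bracket of `A^*`. -/
theorem diffForm_inducedBracket (f g : Func E M) :
    A.diffForm (pair φ₀) (inducedBracket A φ₀ A' X₀ f g)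
      = A'.bracket (A.diffForm (pair φ₀) f) (A.diffForm (pair φ₀) g) := by
  refine dual_ext fun X => ?_
  rw [hA.pair_bracket_diffForm hF]
  have h := A.dFun_bracket (pair φ₀) hA.cocycle g (A'.diffVec (evalAt X₀) f) X
  have h1 := inducedBracket_eq_left (A := A) (φ₀ := φ₀) (A' := A') (X₀ := X₀)
    (pair (A.diffForm (pair φ₀) g) X) f
  have h2 := inducedBracket_eq_left (A := A) (φ₀ := φ₀) (A' := A') (X₀ := X₀) g f
  have h3 (Y : Sec E F V) : pair (A.diffForm (pair φ₀) g) Y = A.dFun (pair φ₀) g Y := by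
    rw [pair_diffForm, dFun_apply]
  have h4 := hA.inducedBracket_skew hF f (pair (A.diffForm (pair φ₀) g) X)
  rw [h4, h1, h3, h3, h, hA.inducedBracket_skew hF f g, pair_diffForm, der_neg_fun,
    A.dFun_apply _ g (A'.diffVec (evalAt X₀) f), ← h2]
  ring

theorem isJacobiBracket : IsJacobiBracket (inducedBracket A φ₀ A' X₀) where
  add_left f g h := by
    simp only [inducedBracket_eq_left, der_add_fun]; ring
  smul_left c f g := by
    simp only [inducedBracket_eq_left, der_smul_real, smul_add, smul_mul_assoc]
  skew := hA.inducedBracket_skew hF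
  mul_left f g h := by
    simp only [inducedBracket_eq_left, der_mul, der_one]; ring
  jacobi f g h := by
    have h1 := A'.dFun_bracket (evalAt X₀) hA.dual_cocycle h (A.diffForm (pair φ₀) f)
      (A.diffForm (pair φ₀) g)
    rw [← hA.diffForm_inducedBracket hF] at h1
    have h2 (u : Func E M) : A'.dFun (evalAt X₀) h (A.diffForm (pair φ₀) u)
        = inducedBracket A φ₀ A' X₀ u h := (pair_ofBidual _ _).symm
    have h3 (u v : Func E M) : der (A'.rho (A.diffForm (pair φ₀) u)) v
        + evalAt X₀ (A.diffForm (pair φ₀) u) * v = inducedBracket A φ₀ A' X₀ u v := by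
      rw [inducedBracket_eq_right, mul_comm]; rfl
    rw [h2, h2, h2, h3, h3] at h1
    have h4 : inducedBracket A φ₀ A' X₀ g (inducedBracket A φ₀ A' X₀ f h)
        = -inducedBracket A φ₀ A' X₀ g (inducedBracket A φ₀ A' X₀ h f) := by
      rw [hA.inducedBracket_skew hF f h, inducedBracket_neg]
    have h5 := hA.inducedBracket_skew hF f (inducedBracket A φ₀ A' X₀ g h)
    have h6 := hA.inducedBracket_skew hF g (inducedBracket A φ₀ A' X₀ h f)
    linear_combination h1 + h5 - h4 + h6

end Rank

end IsGenLieBialgebroid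

end InducedBracket

/-! ### The Lie algebroid of a Jacobi structure -/

theorem pair_sub_left (ξ η : DualSec E F V) (s : Sec E F V) :
    pair (ξ - η) s = pair ξ s - pair η s := rfl

theorem pair_neg_left (ξ : DualSec E F V) (s : Sec E F V) : pair (-ξ) s = -pair ξ s := rfl

theorem fstTMR_mkTMR (X : VField E M) (f : Func E M) : fstTMR (mkTMR X f) = X := rfl

theorem sndTMR_mkTMR (X : VField E M) (f : Func E M) : sndTMR (mkTMR X f) = f := rfl

theorem jet_add (f g : Func E M) : jet (f + g) = jet f + jet g := by
  refine dual_ext fun s => ?_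
  rw [pair_add_left, pair_jet, pair_jet, pair_jet, der_add_fun]
  ring

theorem jet_neg (f : Func E M) : jet (-f) = -jet f := by
  refine dual_ext fun s => ?_
  rw [pair_neg_left, pair_jet, pair_jet, der_neg_fun]
  ring

theorem jet_one : jet (1 : Func E M) = mkDual 0 1 := by
  refine dual_ext fun s => ?_
  rw [pair_jet, pair_mkDual, der_one]
  rfl

/-- A `C^∞(M)`-bilinear skew map on the sections of `T^*M × ℝ` vanishes if it vanishes on jets. -/
theorem jet_induction_skew (T : CoTMR E M → CoTMR E M → Sec E F V)
    (hskew : ∀ ξ η, T ξ η = -T η ξ) (hadd : ∀ ξ η ζ, T ξ (η + ζ) = T ξ η + T ξ ζ)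
    (hsmul : ∀ (f : Func E M) ξ η, T ξ (f • η) = f • T ξ η) (hjet : ∀ f g, T (jet f) (jet g) = 0)
    (ξ η : CoTMR E M) : T ξ η = 0 := by
  have h1 (f η) : T (jet f) η = 0 :=
    jet_induction (T (jet f)) (hadd _) (fun g η => hsmul g _ η) (hjet f) η
  exact jet_induction (T ξ) (hadd ξ) (fun g η => hsmul g ξ η)
    (fun g => by rw [hskew, h1, neg_zero]) η

/-- The case of `jet_induction_skew` for maps with values in `C^∞(M)`. -/
theorem jet_induction_skew_fun (T : CoTMR E M → CoTMR E M → Func E M)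
    (hskew : ∀ ξ η, T ξ η = -T η ξ) (hadd : ∀ ξ η ζ, T ξ (η + ζ) = T ξ η + T ξ ζ)
    (hsmul : ∀ (f : Func E M) ξ η, T ξ (f • η) = f * T ξ η) (hjet : ∀ f g, T (jet f) (jet g) = 0)
    (ξ η : CoTMR E M) : T ξ η = 0 := by
  have h1 (f η) : T (jet f) η = 0 :=
    jet_induction_fun (T (jet f)) (hadd _) (fun g η => hsmul g _ η) (hjet f) η
  exact jet_induction_fun (T ξ) (hadd ξ) (fun g η => hsmul g ξ η)
    (fun g => by rw [hskew, h1, neg_zero]) η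

theorem pair_lieDual_tangent (X : VField E M) (α : DualSec E E (TangentSpace 𝓘(ℝ, E) : M → Type _))
    (Y : VField E M) :
    pair ((tangent E M).lieDual X α) Y = der X (pair α Y) - pair α (vbracket X Y) := by
  rw [LieAlgebroid.pair_lieDual]
  change der (homMap (homOfLinear LinearMap.id) X) _ - _ = _
  rw [homMap_homOfLinear]
  rfl

section Bivector

variable (Λ : Bivector E M) (Z : VField E M)

theorem bivector_skew (α β : DualSec E E (TangentSpace 𝓘(ℝ, E) : M → Type _)) :
    Λ ![α, β] = -Λ ![β, α] := map_vecCons_swap Λ α β ![]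

theorem bivector_smul_right (α β : DualSec E E (TangentSpace 𝓘(ℝ, E) : M → Type _))
    (f : Func E M) : Λ ![α, f • β] = f * Λ ![α, β] := (bivForm Λ α).map_smul f β

theorem bivector_add_right (α β γ : DualSec E E (TangentSpace 𝓘(ℝ, E) : M → Type _)) :
    Λ ![α, β + γ] = Λ ![α, β] + Λ ![α, γ] := (bivForm Λ α).map_add β γ

/-- The anchor of `T^*M × ℝ` on sections. -/
def jacobiRho : CoTMR E M →ₗ[Func E M] VField E M := homMap (jacobiAnchor Λ Z)

theorem jacobiRho_apply (ξ : CoTMR E M) :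
    jacobiRho Λ Z ξ = sharp Λ (formPart ξ) + funPart ξ • Z := by
  rw [jacobiRho, jacobiAnchor, homMap_homOfLinear]
  rfl

theorem pair_jacobiBracket (ξ η : CoTMR E M) (s : Sec E (E × ℝ) (TMR E M)) :
    pair (jacobiBracket Λ Z ξ η) s =
      (der (sharp Λ (formPart ξ)) (pair (formPart η) (fstTMR s))
        - pair (formPart η) (vbracket (sharp Λ (formPart ξ)) (fstTMR s)))
      - (der (sharp Λ (formPart η)) (pair (formPart ξ) (fstTMR s))
        - pair (formPart ξ) (vbracket (sharp Λ (formPart η)) (fstTMR s)))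
      - der (fstTMR s) (Λ ![formPart ξ, formPart η])
      + funPart ξ * (der Z (pair (formPart η) (fstTMR s))
        - pair (formPart η) (vbracket Z (fstTMR s)))
      - funPart η * (der Z (pair (formPart ξ) (fstTMR s))
        - pair (formPart ξ) (vbracket Z (fstTMR s)))
      - (pair (formPart ξ) Z * pair (formPart η) (fstTMR s)
        - pair (formPart η) Z * pair (formPart ξ) (fstTMR s))
      + (Λ ![formPart η, formPart ξ] + der (sharp Λ (formPart ξ)) (funPart η)
        - der (sharp Λ (formPart η)) (funPart ξ) + funPart ξ * der Z (funPart η)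
        - funPart η * der Z (funPart ξ)) * sndTMR s := by
  rw [jacobiBracket, pair_mkDual]
  simp only [pair_sub_left, pair_add_left, pair_smul_left, pair_lieDual_tangent, pair_deRham,
    smul_eq_mul]

theorem vbracket_smul_left (f : Func E M) (X Y : VField E M) :
    vbracket (f • X) Y = f • vbracket X Y - der Y f • X := by
  rw [vbracket_skew, vbracket_smul_right, vbracket_skew Y X, smul_neg, neg_add, neg_neg,
    sub_eq_add_neg]

theorem vbracket_add_left (X Y Z : VField E M) :
    vbracket (X + Y) Z = vbracket X Z + vbracket Y Z := by
  rw [vbracket_skew, vbracket_add_right, neg_add, ← vbracket_skew, ← vbracket_skew]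

theorem jacobiBracket_skew (ξ η : CoTMR E M) :
    jacobiBracket Λ Z ξ η = -jacobiBracket Λ Z η ξ := by
  refine dual_ext fun s => ?_
  rw [pair_neg_left, pair_jacobiBracket, pair_jacobiBracket,
    bivector_skew Λ (formPart η) (formPart ξ), der_neg_fun]
  ring

theorem jacobiBracket_add (ξ η ζ : CoTMR E M) :
    jacobiBracket Λ Z ξ (η + ζ) = jacobiBracket Λ Z ξ η + jacobiBracket Λ Z ξ ζ := by
  refine dual_ext fun s => ?_
  rw [pair_add_left, pair_jacobiBracket, pair_jacobiBracket, pair_jacobiBracket]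
  simp only [map_add, pair_add_left, der_add, der_add_fun, vbracket_add_left, bivector_add_right,
    bivector_skew Λ (_ + _) (formPart ξ), bivector_skew Λ _ (formPart ξ)]
  ring

theorem jacobiBracket_smul (ξ : CoTMR E M) (f : Func E M) (η : CoTMR E M) :
    jacobiBracket Λ Z ξ (f • η)
      = f • jacobiBracket Λ Z ξ η + der (jacobiRho Λ Z ξ) f • η := by
  refine dual_ext fun s => ?_
  have hη : pair η s = pair (formPart η) (fstTMR s) + funPart η * sndTMR s := by
    rw [← pair_mkDual, mkDual_formPart_funPart]
  have hΛ : pair (formPart ξ) (sharp Λ (formPart η)) = -Λ ![formPart ξ, formPart η] := by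
    rw [pair_sharp, bivector_skew]
  rw [pair_add_left, pair_smul_left, pair_smul_left, pair_jacobiBracket, pair_jacobiBracket, hη,
    jacobiRho_apply]
  simp only [map_smul, pair_smul_left, smul_eq_mul, der_add, der_smul, der_mul,
    vbracket_smul_left, bivector_smul_right, map_sub, hΛ,
    bivector_skew Λ (_ • _) (formPart ξ), bivector_skew Λ (formPart η) (formPart ξ)]
  ring

end Bivector

namespace IsJacobiBracket

variable {br : Func E M → Func E M → Func E M} (hbr : IsJacobiBracket br)
include hbr

theorem add_right (f g h : Func E M) : br f (g + h) = br f g + br f h := by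
  rw [hbr.skew, hbr.add_left, neg_add, ← hbr.skew, ← hbr.skew]

theorem mul_right (f g h : Func E M) :
    br f (g * h) = g * br f h + h * br f g + g * h * br 1 f := by
  rw [hbr.skew, hbr.mul_left, hbr.skew f h, hbr.skew f g]
  ring

theorem neg_left (f g : Func E M) : br (-f) g = -br f g := by
  have h := hbr.smul_left (-1) f g
  rwa [neg_one_smul, neg_one_smul] at h

theorem neg_right (f g : Func E M) : br f (-g) = -br f g := by
  rw [hbr.skew, hbr.neg_left, ← hbr.skew]

theorem sub_left (f g h : Func E M) : br (f - g) h = br f h - br g h := by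
  rw [sub_eq_add_neg, hbr.add_left, hbr.neg_left, sub_eq_add_neg]

theorem sub_right (f g h : Func E M) : br f (g - h) = br f g - br f h := by
  rw [sub_eq_add_neg, hbr.add_right, hbr.neg_right, sub_eq_add_neg]

theorem leibniz (f g h : Func E M) : br f (br g h) = br (br f g) h + br g (br f h) := by
  have h1 := hbr.jacobi f g h
  rw [hbr.skew (br g h) f, hbr.skew (br h f) g, hbr.skew h f, hbr.neg_right, neg_neg] at h1
  linear_combination -h1

end IsJacobiBracket

namespace IsJacobiPair

variable {br : Func E M → Func E M → Func E M} {Λ : Bivector E M} {Z : VField E M}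

section

variable (hΛ : IsJacobiPair br Λ Z)
include hΛ

theorem der_sharp (f g : Func E M) :
    der (sharp Λ (deRham f)) g = br f g - f * der Z g + g * der Z f := by
  rw [← pair_deRham, pair_sharp, hΛ.bivector]

/-- The anchor takes the jet of `f` to the Hamiltonian vector field of `f`. -/
theorem der_jacobiRho_jet (f g : Func E M) :
    der (jacobiRho Λ Z (jet f)) g = br f g + g * der Z f := by
  rw [jacobiRho_apply, formPart_jet, funPart_jet, der_add, der_smul, hΛ.der_sharp]
  ring

/-- Taking jets is compatible with the brackets. -/
theorem jacobiBracket_jet (f g : Func E M) :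
    jacobiBracket Λ Z (jet f) (jet g) = jet (br f g) := by
  refine dual_ext fun s => ?_
  rw [pair_jacobiBracket, pair_jet]
  simp only [formPart_jet, funPart_jet, pair_deRham, der_vbracket]
  have hskew : br g f - g * der Z f + f * der Z g = -(br f g - f * der Z g + g * der Z f) := by
    rw [← hΛ.bivector, ← hΛ.bivector, bivector_skew]
  have hskew' : br g f = -br f g := by linear_combination hskew
  rw [hΛ.der_sharp f g, hΛ.der_sharp g f, hΛ.bivector, hΛ.bivector, hskew']
  simp only [der_add_fun, der_sub_fun, der_mul, der_neg_fun]
  ring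

end

variable (hbr : IsJacobiBracket br) (hΛ : IsJacobiPair br Λ Z)
include hbr hΛ

theorem jacobiRho_bracket (ξ η : CoTMR E M) : jacobiRho Λ Z (jacobiBracket Λ Z ξ η)
    = vbracket (jacobiRho Λ Z ξ) (jacobiRho Λ Z η) := by
  refine sub_eq_zero.1 (jet_induction_skew (fun ξ η => jacobiRho Λ Z (jacobiBracket Λ Z ξ η)
    - vbracket (jacobiRho Λ Z ξ) (jacobiRho Λ Z η)) (fun ξ η => ?_) (fun ξ η ζ => ?_)
    (fun f ξ η => ?_) (fun f g => ?_) ξ η)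
  · beta_reduce
    rw [jacobiBracket_skew, map_neg, vbracket_skew]
    abel
  · beta_reduce
    rw [jacobiBracket_add, map_add, map_add, vbracket_add_right]
    abel
  · beta_reduce
    rw [jacobiBracket_smul, map_add, map_smul, map_smul, map_smul, vbracket_smul_right, smul_sub]
    abel
  · beta_reduce
    rw [sub_eq_zero]
    refine vfield_ext fun h => ?_
    rw [hΛ.jacobiBracket_jet, der_vbracket]
    simp only [hΛ.der_jacobiRho_jet, hΛ.vector, hbr.add_right, hbr.mul_right]
    have h1 := hbr.leibniz f g h
    have h2 := hbr.leibniz 1 f g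
    rw [hbr.skew (br 1 f) g] at h2
    linear_combination -h1 + h * h2

theorem jacobiBracket_jacobi (ξ η ζ : CoTMR E M) :
    jacobiBracket Λ Z ξ (jacobiBracket Λ Z η ζ)
      = jacobiBracket Λ Z (jacobiBracket Λ Z ξ η) ζ
        + jacobiBracket Λ Z η (jacobiBracket Λ Z ξ ζ) := by
  -- The Jacobiator is trilinear and totally skew, so it suffices to evaluate it on jets.
  let J (ξ η ζ : CoTMR E M) : CoTMR E M := jacobiBracket Λ Z ξ (jacobiBracket Λ Z η ζ)
    - (jacobiBracket Λ Z (jacobiBracket Λ Z ξ η) ζ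
      + jacobiBracket Λ Z η (jacobiBracket Λ Z ξ ζ))
  have hneg (ξ η : CoTMR E M) : jacobiBracket Λ Z ξ (-η) = -jacobiBracket Λ Z ξ η := by
    rw [eq_neg_iff_add_eq_zero, ← jacobiBracket_add, neg_add_cancel]
    have h := jacobiBracket_add Λ Z ξ 0 0
    rwa [add_zero, left_eq_add] at h
  have hJ1 (ξ η ζ) : J ξ η ζ = -J η ξ ζ := by
    have h : jacobiBracket Λ Z (jacobiBracket Λ Z ξ η) ζ
        = -jacobiBracket Λ Z (jacobiBracket Λ Z η ξ) ζ := by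
      rw [jacobiBracket_skew, jacobiBracket_skew Λ Z ξ η, hneg, ← jacobiBracket_skew]
    simp only [J]
    rw [h]
    abel
  have hJ2 (ξ η ζ) : J ξ η ζ = -J ξ ζ η := by
    simp only [J]
    rw [jacobiBracket_skew Λ Z η ζ, hneg, jacobiBracket_skew Λ Z (jacobiBracket Λ Z ξ η) ζ,
      jacobiBracket_skew Λ Z (jacobiBracket Λ Z ξ ζ) η]
    abel
  have hadd (ξ η ζ ζ') : J ξ η (ζ + ζ') = J ξ η ζ + J ξ η ζ' := by
    simp only [J, jacobiBracket_add]
    abel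
  have hsmul (f : Func E M) (ξ η ζ) : J ξ η (f • ζ) = f • J ξ η ζ := by
    simp only [J, jacobiBracket_smul, jacobiBracket_add, hΛ.jacobiRho_bracket hbr, der_vbracket]
    module
  have hjet (f g h : Func E M) : J (jet f) (jet g) (jet h) = 0 := by
    simp only [J, hΛ.jacobiBracket_jet]
    rw [hbr.leibniz, jet_add, sub_self]
  have h1 (f g ζ) : J (jet f) (jet g) ζ = 0 :=
    jet_induction (J (jet f) (jet g)) (hadd _ _) (fun u ζ => hsmul u _ _ ζ) (hjet f g) ζ
  have h2 (f η ζ) : J (jet f) η ζ = 0 :=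
    jet_induction (J (jet f) η) (hadd _ _) (fun u ζ => hsmul u _ _ ζ)
      (fun h => by rw [hJ2, h1, neg_zero]) ζ
  have h3 (ξ η h) : J ξ η (jet h) = 0 := by rw [hJ2, hJ1, h2, neg_zero, neg_zero]
  exact sub_eq_zero.1 (jet_induction (J ξ η) (hadd _ _) (fun u ζ => hsmul u _ _ ζ) (h3 ξ η) ζ)

/-- The Lie algebroid `T^*M × ℝ` of a Jacobi structure. -/
def jacobiAlgebroid : LieAlgebroid E (E × ℝ →L[ℝ] ℝ) (DualBundle (TMR E M)) where
  bracket := jacobiBracket Λ Z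
  anchor := jacobiAnchor Λ Z
  bracket_add := jacobiBracket_add Λ Z
  bracket_skew := jacobiBracket_skew Λ Z
  bracket_jacobi := hΛ.jacobiBracket_jacobi hbr
  anchor_bracket := hΛ.jacobiRho_bracket hbr
  bracket_smul := jacobiBracket_smul Λ Z

end IsJacobiPair

/-! ### The generalized Lie bialgebroid of a Jacobi structure -/

theorem rho_tangentLine (s : Sec E (E × ℝ) (TMR E M)) : (tangentLine E M).rho s = fstTMR s := by
  change homMap (homOfLinear fstTMR) s = _
  rw [homMap_homOfLinear]

theorem pair_mkDual_zero_one (s : Sec E (E × ℝ) (TMR E M)) : pair (mkDual 0 1) s = sndTMR s := by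
  rw [← jet_one, pair_jet, der_one, zero_add, one_mul]

theorem pair_jet_add (f g : Func E M) (s : Sec E (E × ℝ) (TMR E M)) :
    pair (jet (f + g)) s = pair (jet f) s + pair (jet g) s := by
  rw [jet_add, pair_add_left]

theorem pair_jet_neg (f : Func E M) (s : Sec E (E × ℝ) (TMR E M)) :
    pair (jet (-f)) s = -pair (jet f) s := by
  rw [jet_neg, pair_neg_left]

theorem pair_jet_sub (f g : Func E M) (s : Sec E (E × ℝ) (TMR E M)) :
    pair (jet (f - g)) s = pair (jet f) s - pair (jet g) s := by
  rw [sub_eq_add_neg, pair_jet_add, pair_jet_neg, sub_eq_add_neg]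

/-- The bracket of `TM × ℝ` is the commutator of the operators `f ↦ ⟨jet f, s⟩ = X f + u f`
for `s = (X, u)`. -/
theorem pair_jet_bracket (f : Func E M) (s t : Sec E (E × ℝ) (TMR E M)) :
    pair (jet f) ((tangentLine E M).bracket s t)
      = pair (jet (pair (jet f) t)) s - pair (jet (pair (jet f) s)) t := by
  change pair (jet f) (mkTMR (vbracket (fstTMR s) (fstTMR t))
    (der (fstTMR s) (sndTMR t) - der (fstTMR t) (sndTMR s))) = _
  simp only [pair_jet, fstTMR_mkTMR, sndTMR_mkTMR, der_vbracket, der_add_fun, der_mul]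
  ring

theorem lieDual_jet (f : Func E M) (s : Sec E (E × ℝ) (TMR E M)) :
    (tangentLine E M).lieDual s (jet f) = jet (pair (jet f) s) + (-sndTMR s) • jet f := by
  refine dual_ext fun t => ?_
  rw [LieAlgebroid.pair_lieDual, pair_jet_bracket, rho_tangentLine, pair_add_left, pair_smul_left,
    pair_jet (pair (jet f) t) s, smul_eq_mul]
  ring

theorem isCocycle_tangentLine : (tangentLine E M).IsCocycle (pair (mkDual 0 1)) := fun s t => by
  rw [pair_mkDual_zero_one, pair_mkDual_zero_one, pair_mkDual_zero_one, rho_tangentLine,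
    rho_tangentLine]
  rfl

namespace IsJacobiPair

open LieAlgebroid

variable {br : Func E M → Func E M → Func E M} {Λ : Bivector E M} {Z : VField E M}
section

variable (hΛ : IsJacobiPair br Λ Z)
include hΛ

theorem pair_jet_vector (f : Func E M) : pair (jet f) (mkTMR (-Z) 0) = -br 1 f := by
  rw [pair_jet, fstTMR_mkTMR, sndTMR_mkTMR, der_neg, hΛ.vector]
  ring

theorem bracket_jet_one (ξ : CoTMR E M) :
    jacobiBracket Λ Z (jet 1) ξ = -(tangentLine E M).lieDual (mkTMR (-Z) 0) ξ := by
  have hρ (f : Func E M) : der (jacobiRho Λ Z (jet 1)) f = der Z f := by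
    rw [hΛ.der_jacobiRho_jet, ← hΛ.vector, der_one, mul_zero, add_zero]
  refine eq_neg_of_add_eq_zero_left (jet_induction (fun ξ => jacobiBracket Λ Z (jet 1) ξ
    + (tangentLine E M).lieDual (mkTMR (-Z) 0) ξ) (fun ξ η => ?_) (fun f ξ => ?_) (fun f => ?_) ξ)
  · beta_reduce
    rw [jacobiBracket_add, lieDual_add]
    abel
  · beta_reduce
    rw [jacobiBracket_smul, lieDual_smul, rho_tangentLine, fstTMR_mkTMR, der_neg, hρ]
    module
  · have h0 : (-sndTMR (mkTMR (-Z) 0)) • jet f = 0 := by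
      rw [sndTMR_mkTMR, neg_zero]
      exact zero_smul (Func E M) (jet f)
    rw [hΛ.jacobiBracket_jet, lieDual_jet, hΛ.pair_jet_vector, h0, jet_neg]
    abel

end

variable (hbr : IsJacobiBracket br) (hΛ : IsJacobiPair br Λ Z)
include hbr hΛ

theorem rho_jacobiAlgebroid (ξ : CoTMR E M) :
    (hΛ.jacobiAlgebroid hbr).rho ξ = jacobiRho Λ Z ξ := rfl

theorem bracket_jacobiAlgebroid (ξ η : CoTMR E M) :
    (hΛ.jacobiAlgebroid hbr).bracket ξ η = jacobiBracket Λ Z ξ η := rfl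

theorem isCocycle_jacobiAlgebroid :
    (hΛ.jacobiAlgebroid hbr).IsCocycle (evalAt (mkTMR (-Z) 0)) := fun ξ η => by
  set S := mkTMR (-Z) 0
  change pair (jacobiBracket Λ Z ξ η) S
    = der (jacobiRho Λ Z ξ) (pair η S) - der (jacobiRho Λ Z η) (pair ξ S)
  refine sub_eq_zero.1 (jet_induction_skew_fun (fun ξ η => pair (jacobiBracket Λ Z ξ η) S
    - (der (jacobiRho Λ Z ξ) (pair η S) - der (jacobiRho Λ Z η) (pair ξ S)))
    (fun ξ η => ?_) (fun ξ η ζ => ?_) (fun f ξ η => ?_) (fun f g => ?_) ξ η)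
  · beta_reduce
    rw [jacobiBracket_skew, pair_neg_left]
    ring
  · beta_reduce
    rw [jacobiBracket_add, map_add, pair_add_left, pair_add_left, der_add, der_add_fun]
    ring
  · beta_reduce
    rw [jacobiBracket_smul, map_smul, pair_add_left, pair_smul_left, pair_smul_left,
      pair_smul_left, der_smul, smul_eq_mul, smul_eq_mul, smul_eq_mul, der_mul]
    ring
  · beta_reduce
    rw [hΛ.jacobiBracket_jet, hΛ.pair_jet_vector, hΛ.pair_jet_vector,
      hΛ.pair_jet_vector, hΛ.der_jacobiRho_jet, hΛ.der_jacobiRho_jet, hΛ.vector, hΛ.vector,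
      hbr.neg_right, hbr.neg_right, hbr.leibniz, hbr.skew (br 1 f) g]
    ring

/-- On jets, `d_* s` is the negative of the Lie derivative of the bracket along the operator of
`s`. -/
theorem dVec_jet (s : Sec E (E × ℝ) (TMR E M)) (f g : Func E M) :
    (hΛ.jacobiAlgebroid hbr).dVec (mkTMR (-Z) 0) s (jet f) (jet g)
      = br f (pair (jet g) s) + br (pair (jet f) s) g - pair (jet (br f g)) s := by
  rw [dVec_eq, rho_jacobiAlgebroid, rho_jacobiAlgebroid, bracket_jacobiAlgebroid,
    hΛ.jacobiBracket_jet, hΛ.pair_jet_vector, hΛ.pair_jet_vector, hΛ.der_jacobiRho_jet,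
    hΛ.der_jacobiRho_jet, hΛ.vector, hΛ.vector, hbr.skew (pair (jet f) s) g]
  ring

theorem dVec_bracket (s t : Sec E (E × ℝ) (TMR E M)) (ξ η : CoTMR E M) :
    (hΛ.jacobiAlgebroid hbr).dVec (mkTMR (-Z) 0) ((tangentLine E M).bracket s t) ξ η =
      (tangentLine E M).schoutenDef' (pair (mkDual 0 1))
          ((hΛ.jacobiAlgebroid hbr).dDef (evalAt (mkTMR (-Z) 0)) (oneVec s)) t ![ξ, η]
        + (tangentLine E M).schoutenDef (pair (mkDual 0 1)) s
          ((hΛ.jacobiAlgebroid hbr).dDef (evalAt (mkTMR (-Z) 0)) (oneVec t)) ![ξ, η] := by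
  set T := hΛ.jacobiAlgebroid hbr with hT
  set S := mkTMR (-Z) 0
  set D := T.dVec S with hD
  -- `R s t` is the deformed Schouten bracket of `s` with `d_* t`.
  let R (s t) (ξ η : CoTMR E M) : Func E M := der (fstTMR s) (D t ξ η)
    - (D t ((tangentLine E M).lieDual s ξ) η + D t ξ ((tangentLine E M).lieDual s η))
    - sndTMR s * D t ξ η
  have hR (s t) : (tangentLine E M).schoutenDef (pair (mkDual 0 1)) s
      (T.dDef (evalAt S) (oneVec t)) ![ξ, η] = R s t ξ η := by
    rw [schoutenDef_two, pair_mkDual_zero_one, rho_tangentLine]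
    rfl
  rw [schoutenDef', hR, hR]
  have hskew (s t ξ η) : R s t ξ η = -R s t η ξ := by
    simp only [R, hD]
    rw [dVec_skew T S t ξ η, dVec_skew T S t _ η, dVec_skew T S t ξ _, der_neg_fun]
    ring
  have hadd (s t ξ η ζ) : R s t ξ (η + ζ) = R s t ξ η + R s t ξ ζ := by
    simp only [R, hD, lieDual_add, dVec_add_right, der_add_fun]
    ring
  have hsmul (s t) (f : Func E M) (ξ η) : R s t ξ (f • η) = f * R s t ξ η := by
    simp only [R, hD, lieDual_smul, dVec_add_right, dVec_smul_right, der_mul, rho_tangentLine]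
    ring
  refine sub_eq_zero.1 (jet_induction_skew_fun (fun ξ η => D ((tangentLine E M).bracket s t) ξ η
    - (-R t s ξ η + R s t ξ η)) (fun ξ η => ?_) (fun ξ η ζ => ?_) (fun f ξ η => ?_)
    (fun f g => ?_) ξ η)
  · rw [hskew s t, hskew t s, hD, dVec_skew]
    ring
  · beta_reduce
    rw [hadd, hadd, hD, dVec_add_right]
    ring
  · beta_reduce
    rw [hsmul, hsmul, hD, dVec_smul_right]
    ring
  · have hRj (s t : Sec E (E × ℝ) (TMR E M)) : R s t (jet f) (jet g)
        = pair (jet (D t (jet f) (jet g))) s - D t (jet (pair (jet f) s)) (jet g)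
          - D t (jet f) (jet (pair (jet g) s)) := by
      simp only [R, hD]
      rw [lieDual_jet, lieDual_jet, dVec_add_left, dVec_add_right, dVec_smul_left, dVec_smul_right,
        pair_jet (D t (jet f) (jet g)) s]
      ring
    rw [hRj, hRj, hD]
    simp only [hT, S, hΛ.dVec_jet hbr, pair_jet_bracket, pair_jet_add, pair_jet_sub,
      hbr.sub_left, hbr.sub_right]
    ring

/-- A Jacobi structure defines a generalized Lie bialgebroid. -/
theorem isGenLieBialgebroid : IsGenLieBialgebroid (tangentLine E M) (mkDual 0 1)
    (hΛ.jacobiAlgebroid hbr) (mkTMR (-Z) 0) where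
  cocycle := isCocycle_tangentLine
  dual_cocycle := hΛ.isCocycle_jacobiAlgebroid hbr
  compat s t α := by
    have hα : α = ![α 0, α 1] := by funext j; fin_cases j <;> rfl
    rw [hα]
    exact hΛ.dVec_bracket hbr s t (α 0) (α 1)
  lie_add p P α := by
    have h1 : pair (mkDual 0 1) (mkTMR (-Z) 0) = 0 := pair_mkDual_zero_one _
    have h2 : evalAt (mkTMR (-Z) 0) (mkDual 0 1) = 0 := h1
    have hρ (f : Func E M) : der (jacobiRho Λ Z (mkDual 0 1)) f = der Z f := by
      rw [← jet_one, hΛ.der_jacobiRho_jet, ← hΛ.vector, der_one, mul_zero, add_zero]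
    rw [lieForm_eq, schoutenDef, schouten, h1, h2, rho_jacobiAlgebroid, hρ, rho_tangentLine,
      fstTMR_mkTMR, der_neg]
    have h3 (i : Fin p) : P (Function.update α i
        ((hΛ.jacobiAlgebroid hbr).bracket (mkDual 0 1) (α i)))
        = -P (Function.update α i ((tangentLine E M).lieDual (mkTMR (-Z) 0) (α i))) := by
      rw [bracket_jacobiAlgebroid, ← jet_one, hΛ.bracket_jet_one, P.map_update_neg]
    rw [Finset.sum_congr rfl fun i _ => h3 i, Finset.sum_neg_distrib]
    simp

end IsJacobiPair

/-! ### The Jacobi structure of a generalized Lie bialgebroid -/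

theorem pair_dualMap (Φ : BundleMap E F V F' W) (η : DualSec E F' W) (X : Sec E F V) :
    pair (homMap (dualMap Φ) η) X = pair η (homMap Φ X) := rfl

section CanonicalMap

open LieAlgebroid

variable {A : LieAlgebroid E F V} {φ₀ : DualSec E F V}
  {A' : LieAlgebroid E (F →L[ℝ] ℝ) (DualBundle V)} {X₀ : Sec E F V}

theorem dualMap_canonicalMap_jet (f : Func E M) :
    homMap (dualMap (canonicalMap A φ₀)) (jet f) = A.diffForm (pair φ₀) f := by
  refine dual_ext fun X => ?_
  rw [pair_dualMap, homMap_canonicalMap, pair_jet, pair_diffForm, fstTMR_mkTMR, sndTMR_mkTMR]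

theorem dualMap_anchor_deRham (f : Func E M) :
    homMap (dualMap A.anchor) (deRham f) = A.diffForm 0 f := by
  refine dual_ext fun X => ?_
  rw [pair_dualMap, pair_deRham, pair_diffForm, LinearMap.zero_apply, mul_zero, add_zero]

namespace IsGenLieBialgebroid

variable (hA : IsGenLieBialgebroid A φ₀ A' X₀) (hF : Module.finrank ℝ F ≠ 1)
include hA hF

/-- The bivector field `Λ(α, β) = ⟨ρ^* α, ρ_*^* β⟩`, whose skew-symmetry on exact forms is
`der_diffForm_skew`. -/
def bivector : Bivector E M where
  toFun v := pair (v 1) (A'.rho (homMap (dualMap A.anchor) (v 0)))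
  map_update_add' v i α β := by
    fin_cases i <;> simp [pair_add_left]
  map_update_smul' v i f α := by
    fin_cases i <;> simp [pair_smul_left]
  map_eq_zero_of_eq' v i j hv hij := by
    have h : v 0 = v 1 := by
      fin_cases i <;> fin_cases j <;> first | exact absurd rfl hij | exact hv | exact hv.symm
    rw [h]
    set α := v 1
    ext x
    -- At `x` the covector `α x` is the differential of a function.
    obtain ⟨f, hf⟩ := exists_deRham_eq α x
    have h1 := congrArg (fun u : Func E M => u x) (hA.der_diffForm_skew hF f f)
    have h2 : pair (deRham f) (A'.rho (homMap (dualMap A.anchor) (deRham f))) x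
        = der (A'.rho (A.diffForm 0 f)) f x := by
      rw [pair_deRham, dualMap_anchor_deRham]
    have h3 : A'.rho (homMap (dualMap A.anchor) α) x
        = A'.rho (homMap (dualMap A.anchor) (deRham f)) x :=
      tensorial_eq (A'.rho ∘ₗ homMap (dualMap A.anchor)) hf.symm
    have h4 : der (A'.rho (A.diffForm 0 f)) f x = -der (A'.rho (A.diffForm 0 f)) f x := h1
    rw [← pair_eq_of_eq hf, pair_apply, h3, ← pair_apply, h2]
    change _ = (0 : ℝ)
    linarith

theorem exists_isJacobiPair :
    ∃ Λ Z, IsJacobiPair (inducedBracket A φ₀ A' X₀) Λ Z := by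
  refine ⟨hA.bivector hF, -A.rho X₀, fun f => ?_, fun f g => ?_⟩
  · have h : A.diffForm 0 (1 : Func E M) = 0 := dual_ext fun X => by
      rw [pair_diffForm, der_one, LinearMap.zero_apply, mul_zero, add_zero]; rfl
    rw [hA.inducedBracket_eq hF, h, map_zero, der_zero, der_one, der_neg]
    ring
  · change pair (deRham g) (A'.rho (homMap (dualMap A.anchor) (deRham f))) = _
    rw [pair_deRham, dualMap_anchor_deRham, hA.inducedBracket_eq hF, der_neg, der_neg]
    ring

variable {Λ : Bivector E M} {Z : VField E M}
  (hΛ : IsJacobiPair (inducedBracket A φ₀ A' X₀) Λ Z)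
include hΛ

theorem rho_vector : A.rho X₀ = -Z := by
  refine vfield_ext fun f => ?_
  have h : A.diffForm 0 (1 : Func E M) = 0 := dual_ext fun X => by
    rw [pair_diffForm, der_one, LinearMap.zero_apply, mul_zero, add_zero]; rfl
  rw [der_neg, hΛ.vector, hA.inducedBracket_eq hF, h, map_zero, der_zero, der_one]
  ring

theorem rho_dualMap_canonicalMap (ξ : CoTMR E M) :
    A'.rho (homMap (dualMap (canonicalMap A φ₀)) ξ) = jacobiRho Λ Z ξ := by
  refine sub_eq_zero.1 (jet_induction (fun ξ =>
    A'.rho (homMap (dualMap (canonicalMap A φ₀)) ξ) - jacobiRho Λ Z ξ)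
    (fun ξ η => ?_) (fun f ξ => ?_) (fun f => ?_) ξ)
  · beta_reduce
    rw [map_add, map_add, map_add]
    abel
  · beta_reduce
    rw [map_smul, map_smul, map_smul, smul_sub]
  · beta_reduce
    rw [sub_eq_zero]
    refine vfield_ext fun g => ?_
    have h := hA.rho_vector hF hΛ
    have h1 := hA.pair_cocycles
    rw [dualMap_canonicalMap_jet, hΛ.der_jacobiRho_jet, inducedBracket_eq_right,
      pair_diffForm, h, h1, der_neg]
    ring

theorem dualMap_canonicalMap_bracket (ξ η : CoTMR E M) :
    homMap (dualMap (canonicalMap A φ₀)) (jacobiBracket Λ Z ξ η)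
      = A'.bracket (homMap (dualMap (canonicalMap A φ₀)) ξ)
        (homMap (dualMap (canonicalMap A φ₀)) η) := by
  set Φ := homMap (dualMap (canonicalMap A φ₀)) with hΦ
  refine sub_eq_zero.1 (jet_induction_skew (fun ξ η =>
    Φ (jacobiBracket Λ Z ξ η) - A'.bracket (Φ ξ) (Φ η))
    (fun ξ η => ?_) (fun ξ η ζ => ?_) (fun f ξ η => ?_) (fun f g => ?_) ξ η)
  · rw [jacobiBracket_skew, map_neg, A'.bracket_skew]
    abel
  · beta_reduce
    rw [jacobiBracket_add, map_add, map_add, A'.bracket_add]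
    abel
  · beta_reduce
    rw [jacobiBracket_smul, map_add, map_smul, map_smul, map_smul, A'.bracket_smul,
      hA.rho_dualMap_canonicalMap hF hΛ]
    module
  · rw [hΛ.jacobiBracket_jet, hΦ, dualMap_canonicalMap_jet,
      dualMap_canonicalMap_jet, dualMap_canonicalMap_jet,
      hA.diffForm_inducedBracket hF, sub_self]

theorem isGenLieBialgebroidHom_canonicalMap :
    IsGenLieBialgebroidHom A φ₀ A' X₀ (tangentLine E M) (mkDual 0 1)
      (hΛ.jacobiAlgebroid (hA.isJacobiBracket hF)) (mkTMR (-Z) 0) (canonicalMap A φ₀) where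
  hom := {
    anchor := fun X => by rw [rho_tangentLine, homMap_canonicalMap, fstTMR_mkTMR]
    bracket := fun X Y => by
      rw [homMap_canonicalMap, homMap_canonicalMap, homMap_canonicalMap, A.rho_bracket,
        hA.cocycle]
      rfl }
  dual_hom := {
    anchor := fun ξ => hA.rho_dualMap_canonicalMap hF hΛ ξ
    bracket := fun ξ η => hA.dualMap_canonicalMap_bracket hF hΛ ξ η }
  map_section := by
    rw [homMap_canonicalMap, hA.pair_cocycles, hA.rho_vector hF hΛ]
  map_cocycle := dual_ext fun X => by
    rw [pair_dualMap, homMap_canonicalMap, pair_mkDual_zero_one, sndTMR_mkTMR]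

end IsGenLieBialgebroid

end CanonicalMap

/-! ### Invariance of the induced bracket -/

/-- A morphism satisfies `Φ^*(d^{ψ₀} f) = d^{φ₀} f` and `Φ(d_*^{X₀} g) = d_*^{Y₀} g`, hence
preserves their pairing. -/
theorem IsGenLieBialgebroidHom.inducedBracket_eq {A : LieAlgebroid E F V} {φ₀ : DualSec E F V}
    {A' : LieAlgebroid E (F →L[ℝ] ℝ) (DualBundle V)} {X₀ : Sec E F V}
    {B : LieAlgebroid E F' W} {ψ₀ : DualSec E F' W}
    {B' : LieAlgebroid E (F' →L[ℝ] ℝ) (DualBundle W)} {Y₀ : Sec E F' W}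
    {Φ : BundleMap E F V F' W} (hΦ : IsGenLieBialgebroidHom A φ₀ A' X₀ B ψ₀ B' Y₀ Φ)
    (f g : Func E M) : inducedBracket A φ₀ A' X₀ f g = inducedBracket B ψ₀ B' Y₀ f g := by
  have h1 : homMap (dualMap Φ) (B.diffForm (pair ψ₀) f) = A.diffForm (pair φ₀) f := by
    refine dual_ext fun X => ?_
    rw [pair_dualMap, LieAlgebroid.pair_diffForm, LieAlgebroid.pair_diffForm, hΦ.hom.anchor,
      ← hΦ.map_cocycle, pair_dualMap]
  have h2 : homMap Φ (A'.diffVec (evalAt X₀) g) = B'.diffVec (evalAt Y₀) g := by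
    refine sec_ext fun η => ?_
    rw [← pair_dualMap, LieAlgebroid.pair_diffVec, LieAlgebroid.pair_diffVec, hΦ.dual_hom.anchor,
      ← hΦ.map_section]
    rfl
  change pair (A.diffForm (pair φ₀) f) (A'.diffVec (evalAt X₀) g)
    = pair (B.diffForm (pair ψ₀) f) (B'.diffVec (evalAt Y₀) g)
  rw [← h1, ← h2, pair_dualMap]

end GLB

end

theorem theorem4p16
    {E : Type*} [NormedAddCommGroup E] [NormedSpace ℝ E] [FiniteDimensional ℝ E]
    {M : Type*} [TopologicalSpace M] [ChartedSpace E M] [IsManifold 𝓘(ℝ, E) ∞ M] [T2Space M]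
    {F : Type*} [NormedAddCommGroup F] [NormedSpace ℝ F] [FiniteDimensional ℝ F]
    {V : M → Type*} [∀ x, AddCommGroup (V x)] [∀ x, Module ℝ (V x)]
    [∀ x, TopologicalSpace (V x)] [∀ x, IsTopologicalAddGroup (V x)]
    [∀ x, ContinuousSMul ℝ (V x)]
    [TopologicalSpace (TotalSpace F V)] [FiberBundle F V] [VectorBundle ℝ F V]
    [ContMDiffVectorBundle ∞ F V 𝓘(ℝ, E)]
    (A : GLB.LieAlgebroid E F V) (φ₀ : GLB.DualSec E F V)
    (A' : GLB.LieAlgebroid E (F →L[ℝ] ℝ) (GLB.DualBundle V)) (X₀ : GLB.Sec E F V)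
    (hA : GLB.IsGenLieBialgebroid A φ₀ A' X₀)
    {F' : Type*} [NormedAddCommGroup F'] [NormedSpace ℝ F'] [FiniteDimensional ℝ F']
    {W : M → Type*} [∀ x, AddCommGroup (W x)] [∀ x, Module ℝ (W x)]
    [∀ x, TopologicalSpace (W x)] [∀ x, IsTopologicalAddGroup (W x)]
    [∀ x, ContinuousSMul ℝ (W x)]
    [TopologicalSpace (TotalSpace F' W)] [FiberBundle F' W] [VectorBundle ℝ F' W]
    [ContMDiffVectorBundle ∞ F' W 𝓘(ℝ, E)]
    (B : GLB.LieAlgebroid E F' W) (ψ₀ : GLB.DualSec E F' W)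
    (B' : GLB.LieAlgebroid E (F' →L[ℝ] ℝ) (GLB.DualBundle W)) (Y₀ : GLB.Sec E F' W)
    (hB : GLB.IsGenLieBialgebroid B ψ₀ B' Y₀) :
    (Module.finrank ℝ F ≠ 1 →
      GLB.IsJacobiBracket (GLB.inducedBracket A φ₀ A' X₀) ∧
      (∃ Λ Z, GLB.IsJacobiPair (GLB.inducedBracket A φ₀ A' X₀) Λ Z) ∧
      ∀ Λ Z, GLB.IsJacobiPair (GLB.inducedBracket A φ₀ A' X₀) Λ Z →
        ∃ T' : GLB.LieAlgebroid E (E × ℝ →L[ℝ] ℝ) (GLB.DualBundle (GLB.TMR E M)),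
          T'.bracket = GLB.jacobiBracket Λ Z ∧
          T'.anchor = GLB.jacobiAnchor Λ Z ∧
          GLB.IsGenLieBialgebroid (GLB.tangentLine E M) (GLB.mkDual 0 1)
            T' (GLB.mkTMR (-Z) 0) ∧
          GLB.IsGenLieBialgebroidHom A φ₀ A' X₀
            (GLB.tangentLine E M) (GLB.mkDual 0 1) T' (GLB.mkTMR (-Z) 0)
            (GLB.canonicalMap A φ₀)) ∧
    ∀ Ψ : GLB.BundleMap E F V F' W,
      GLB.IsGenLieBialgebroidHom A φ₀ A' X₀ B ψ₀ B' Y₀ Ψ →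
        ∀ f g : GLB.Func E M,
          GLB.inducedBracket A φ₀ A' X₀ f g = GLB.inducedBracket B ψ₀ B' Y₀ f g := by
  refine ⟨fun hF => ⟨hA.isJacobiBracket hF, hA.exists_isJacobiPair hF, fun Λ Z hΛ => ?_⟩,
    fun Ψ hΨ f g => hΨ.inducedBracket_eq f g⟩
  exact ⟨hΛ.jacobiAlgebroid (hA.isJacobiBracket hF), rfl, rfl, hΛ.isGenLieBialgebroid _,
    hA.isGenLieBialgebroidHom_canonicalMap hF hΛ⟩
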